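/- **Theorem (time uniform bound of the chemical potential in $H^1$).** *Setting.* Let $d\in\{1,2,3\}$. Either (Neumann) $\Omega\subset\mathbb R^d$ is a bounded domain with $C^2$ boundary, or (periodic) $\Omega=(0,L)^d$ with $L>0$. Let $V=H^1(\Omega)$ in the Neumann case, and let $V$ be the set of $L$-periodic functions of $H^1(\Omega)$ in the periodic case. Let $A=-\Delta$ with domain $\mathcal D(A)=\{v\in H^2(\Omega):\partial v/\partial\nu=0 \text{ on }\partial\Omega\}$ in the Neumann case, and $\mathcal D(A)=H^2_{\rm per}(\Omega)$ in the periodic case. Write $m(v)=\frac1{|\Omega|}\int_\Omega v\,dx$, $\bar v=v-m(v)$, $|v|_1=\|A^{1/2}v\|=\|\nabla v\|_{L^2(\Omega)}$ for $v\in V$, and $|v|_{-1}=\sup_{\chi\in V}|(v,\chi)|/|\chi|_1$ for $v\in L^2(\Omega)$ with $m(v)=0$. Let $\gamma_1>0$ be a constant such that $|\bar v|_{-1}\le\gamma_1|v|_1$ for all $v\in V$. *Nonlinearity.* Let $\varepsilon>0$, let $f:\mathbb R\to\mathbb R$ be differentiable, and let $F$ be its primitive with $F(0)=0$. Let $p\in[2,\infty)$,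 with $p=2$ if $d=3$. Assume that there are constants $c_0>0$, $c>0$, $c_1,c_3\in\mathbb R$ and, for every $\eta>0$, a constant $c_2(\eta)$ such that for all $v\in\mathbb R$ $$f(v)v\ge pc_0|v|^{2p}-c_1,\qquad |f(v)|\le\eta c_0|v|^{2p}+c_2(\eta),$$ $$\tfrac12c_0|v|^{2p}-c_3\le F(v)\le\tfrac32c_0|v|^{2p}+c_3,\qquad F''(v)\ge -c.$$ *Constants.* Let $\alpha>0$, $R\ge0$, $r>0$, and put $c_2=c_2(\eta)$ with $\eta=\frac1\alpha\left(p-\frac32\right)$. Let $$C_0(\alpha)=(c_2\alpha+c_1+c_3)|\Omega|,\qquad C_1(\alpha)=(c_1+c_2\alpha+2c_3)|\Omega|,$$ $$\hat\rho_0=\sqrt{2C_1(\alpha)}\left(\frac{\gamma_1^2}{\varepsilon}+\frac{8\varepsilon}{c^2}\right)^{1/2},\qquad \hat\rho_0'=2\hat\rho_0,\qquad C_2(r)=C_0(\alpha)+\frac{(\hat\rho_0')^2}{2r}.$$ *Scheme.* Let $0=t^0<t^1<\cdots$ with $t^n\to\infty$, let $k_n=t^{n+1}-t^n$, and assume that $k=\sup_{n\ge0}k_n$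 satisfies $$k<\frac{2\varepsilon}{c^2}.$$ For $u_0\in L^2(\Omega)$, consider sequences with $u^0=u_0$, $u^{n+1},\omega^{n+1}\in\mathcal D(A)$ and, for all $n\ge0$, $$\frac{u^{n+1}-u^n}{k_n}+A\omega^{n+1}=0,\qquad \omega^{n+1}=\varepsilon Au^{n+1}+f(u^{n+1}).$$ *Conclusion.* There are integers $n_0\ge1$, $N_1$ and $n_\omega$ such that $$t^{n_0}\ge\left(\frac{\gamma_1^2}{\varepsilon}+\frac{8\varepsilon}{c^2}\right)\ln\frac{R^2}{\hat\rho_0^2},\qquad t^{n_0+N_1}-t^{n_0}\ge r,\qquad r_1:=t^{n_\omega}-t^{n_0+N_1}>0$$ (the first condition being void if $R=0$), and for all such $n_0,N_1,n_\omega$, every solution of the scheme whose initial value satisfies $|\overline{u_0}|_{-1}\le R$ and $|m(u_0)|\le\alpha$ obeys $$|\omega^n|_1\le\rho_\omega\qquad\text{for all } n\ge n_\omega,$$ where $$\rho_\omega^2=\left(\frac{c^2}{4\varepsilon}C_1(\alpha)+\frac{c^2(\hat\rho_0')^2}{8\varepsilon r_1}+\frac{C_2(r)}{r_1}\right)\exp\left(\frac{2c^2r_1}{\varepsilon}\right).$$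 -/

import Mathlib

open MeasureTheory Set Filter Topology
open scoped ContDiff ENNReal

namespace CahnHilliard

/-- The space `ℝ^d` with its Euclidean norm. -/
abbrev Space (d : ℕ) : Type := EuclideanSpace ℝ (Fin d)

/-- The two boundary conditions: homogeneous Neumann (no flux), and periodic with period `L` in
each coordinate direction. -/
inductive BoundaryCondition : Type
  | neumann : BoundaryCondition
  | periodic (L : ℝ) : BoundaryCondition

/-- `Ω` has a boundary of class `C²` and lies locally on one side of it. -/
def HasC2Boundary {d : ℕ} (Ω : Set (Space d)) : Prop :=
  ∀ x₀ ∈ frontier Ω, ∃ (U : Set (Space d)) (ψ : Space d → ℝ),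
    IsOpen U ∧ x₀ ∈ U ∧ ContDiffOn ℝ 2 ψ U ∧ fderiv ℝ ψ x₀ ≠ 0 ∧
      Ω ∩ U = {x | x ∈ U ∧ ψ x < 0}

/-- The domains considered: a bounded connected open set with `C²` boundary in the Neumann case,
the cube `(0, L)^d` in the periodic case. -/
def IsAdmissibleDomain {d : ℕ} : BoundaryCondition → Set (Space d) → Prop
  | .neumann, Ω => IsOpen Ω ∧ IsConnected Ω ∧ Bornology.IsBounded Ω ∧ HasC2Boundary Ω
  | .periodic L, Ω => 0 < L ∧ Ω = {x | ∀ i, x i ∈ Ioo 0 L}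

noncomputable section

/-- The `i`-th canonical basis vector. -/
def unitVec {d : ℕ} (i : Fin d) : Space d := EuclideanSpace.single i 1

/-- `v ∈ L²(Ω)`. -/
def MemL2 {d : ℕ} (Ω : Set (Space d)) (v : Space d → ℝ) : Prop :=
  MemLp v 2 (volume.restrict Ω)

/-- The inner product of `L²(Ω)`. -/
def innerL2 {d : ℕ} (Ω : Set (Space d)) (v χ : Space d → ℝ) : ℝ :=
  ∫ x in Ω, v x * χ x

/-- The average `m(v)` of `v` over `Ω`. -/
def mean {d : ℕ} (Ω : Set (Space d)) (v : Space d → ℝ) : ℝ :=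
  (volume.real Ω)⁻¹ * ∫ x in Ω, v x

/-- `v - m(v)`. -/
def meanFree {d : ℕ} (Ω : Set (Space d)) (v : Space d → ℝ) : Space d → ℝ :=
  fun x => v x - mean Ω v

/-- `g` is the `i`-th weak partial derivative of `v` in `Ω`. -/
def IsWeakPartial {d : ℕ} (Ω : Set (Space d)) (i : Fin d) (v g : Space d → ℝ) : Prop :=
  ∀ φ : Space d → ℝ, ContDiff ℝ ∞ φ → HasCompactSupport φ → tsupport φ ⊆ Ω →
    ∫ x in Ω, v x * fderiv ℝ φ x (unitVec i) = -∫ x in Ω, g x * φ x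

/-- `v` belongs to the Sobolev space `H¹(Ω)`. -/
def MemH1 {d : ℕ} (Ω : Set (Space d)) (v : Space d → ℝ) : Prop :=
  MemL2 Ω v ∧ ∀ i, ∃ g, MemL2 Ω g ∧ IsWeakPartial Ω i v g

open Classical in
/-- The weak partial derivative in `L²(Ω)` (unique up to null sets; zero if there is none). -/
def weakPartial {d : ℕ} (Ω : Set (Space d)) (i : Fin d) (v : Space d → ℝ) : Space d → ℝ :=
  if h : ∃ g, MemL2 Ω g ∧ IsWeakPartial Ω i v g then h.choose else 0

/-- `v` belongs to the Sobolev space `H²(Ω)`. -/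
def MemH2 {d : ℕ} (Ω : Set (Space d)) (v : Space d → ℝ) : Prop :=
  MemH1 Ω v ∧ ∀ i, MemH1 Ω (weakPartial Ω i v)

/-- The Dirichlet form `∫_Ω ∇v · ∇χ`. -/
def gradInner {d : ℕ} (Ω : Set (Space d)) (v χ : Space d → ℝ) : ℝ :=
  ∫ x in Ω, ∑ i, weakPartial Ω i v x * weakPartial Ω i χ x

/-- The seminorm `|v|₁ = ‖A^{1/2} v‖ = ‖∇v‖_{L²(Ω)}`. -/
def normOne {d : ℕ} (Ω : Set (Space d)) (v : Space d → ℝ) : ℝ :=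
  Real.sqrt (gradInner Ω v v)

/-- The negative Laplacian `-Δv`, for `v ∈ H²(Ω)`. -/
def negLaplacian {d : ℕ} (Ω : Set (Space d)) (v : Space d → ℝ) : Space d → ℝ :=
  fun x => -∑ i, weakPartial Ω i (weakPartial Ω i v) x

/-- The form domain `D(A^{1/2})`: `H¹(Ω)` in the Neumann case, and the periodic functions of
`H¹(Ω)` in the periodic case. Periodicity (equal traces on opposite faces of the cube) means that
no boundary term appears when one integrates by parts against smooth periodic functions. -/
def FormDomain {d : ℕ} : BoundaryCondition → Set (Space d) → (Space d → ℝ) → Prop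
  | .neumann, Ω, v => MemH1 Ω v
  | .periodic L, Ω, v => MemH1 Ω v ∧
      ∀ φ : Space d → ℝ, ContDiff ℝ ∞ φ → (∀ i x, φ (x + L • unitVec i) = φ x) →
        ∀ i, ∫ x in Ω, v x * fderiv ℝ φ x (unitVec i) = -∫ x in Ω, weakPartial Ω i v x * φ x

/-- The domain `D(A)` of `A = -Δ`: the functions of `H²(Ω)` that satisfy the boundary condition.
The condition on the normal derivative (zero in the Neumann case, periodic in the periodic case)
is expressed by Green's formula. -/
def DomA {d : ℕ} (bc : BoundaryCondition) (Ω : Set (Space d)) (v : Space d → ℝ) : Prop :=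
  FormDomain bc Ω v ∧ MemH2 Ω v ∧
    ∀ χ, FormDomain bc Ω χ → gradInner Ω v χ = innerL2 Ω (negLaplacian Ω v) χ

/-- The dual norm `|v|₋₁ = sup_χ |(v, χ)| / |χ|₁` over the form domain, for `v ∈ L²(Ω)` of mean
zero, with values in `[0, ∞]`. -/
def normNegOne {d : ℕ} (bc : BoundaryCondition) (Ω : Set (Space d)) (v : Space d → ℝ) : ℝ≥0∞ :=
  ⨆ (χ : Space d → ℝ) (_ : FormDomain bc Ω χ),
    ENNReal.ofReal |innerL2 Ω v χ| / ENNReal.ofReal (normOne Ω χ)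

/-- `t` is a partition `0 = t⁰ < t¹ < ⋯` of `[0, ∞)`. -/
def IsTimePartition (t : ℕ → ℝ) : Prop :=
  t 0 = 0 ∧ StrictMono t ∧ Tendsto t atTop atTop

/-- `u`, `w` is a solution of the implicit Euler scheme with initial value `u₀ ∈ L²(Ω)`:
`(uⁿ⁺¹ - uⁿ) / kₙ + A wⁿ⁺¹ = 0` and `wⁿ⁺¹ = ε A uⁿ⁺¹ + f(uⁿ⁺¹)`, with `kₙ = tⁿ⁺¹ - tⁿ`.
The value `w 0` plays no role. -/
structure IsEulerSolution {d : ℕ} (bc : BoundaryCondition) (Ω : Set (Space d)) (ε : ℝ)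
    (f : ℝ → ℝ) (t : ℕ → ℝ) (u₀ : Space d → ℝ) (u w : ℕ → Space d → ℝ) : Prop where
  initial_mem : MemL2 Ω u₀
  initial : u 0 = u₀
  mem_u : ∀ n, DomA bc Ω (u (n + 1))
  mem_w : ∀ n, DomA bc Ω (w (n + 1))
  step : ∀ n, ∀ᵐ x ∂(volume.restrict Ω),
    (u (n + 1) x - u n x) / (t (n + 1) - t n) + negLaplacian Ω (w (n + 1)) x = 0
  potential : ∀ n, ∀ᵐ x ∂(volume.restrict Ω),
    w (n + 1) x = ε * negLaplacian Ω (u (n + 1)) x + f (u (n + 1) x)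

/-- `C₀(α) = (c₂ α + c₁ + c₃) |Ω|`. -/
def constC0 (c₁ c₂ c₃ α vol : ℝ) : ℝ := (c₂ * α + c₁ + c₃) * vol

/-- `C₁(α) = (c₁ + c₂ α + 2 c₃) |Ω|`. -/
def constC1 (c₁ c₂ c₃ α vol : ℝ) : ℝ := (c₁ + c₂ * α + 2 * c₃) * vol

/-- `ρ̂₀ = √(2 C₁(α)) (γ₁² / ε + 8 ε / c²)^{1/2}`. -/
def rhoHat (ε c γ₁ C₁ : ℝ) : ℝ :=
  Real.sqrt (2 * C₁) * Real.sqrt (γ₁ ^ 2 / ε + 8 * ε / c ^ 2)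

/-- `ρ̂₀' = 2 ρ̂₀`. -/
def rhoHatPrime (ε c γ₁ C₁ : ℝ) : ℝ := 2 * rhoHat ε c γ₁ C₁

/-- `C₂(r) = C₀(α) + (ρ̂₀')² / (2 r)`. -/
def constC2 (C₀ ρ' r : ℝ) : ℝ := C₀ + ρ' ^ 2 / (2 * r)

/-- `ρ_ω² = (c²/(4ε) C₁(α) + c² (ρ̂₀')² / (8 ε r₁) + C₂(r) / r₁) exp(2 c² r₁ / ε)`. -/
def rhoOmegaSq (ε c C₁ ρ' C₂ r₁ : ℝ) : ℝ :=
  (c ^ 2 / (4 * ε) * C₁ + c ^ 2 * ρ' ^ 2 / (8 * ε * r₁) + C₂ / r₁) *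
    Real.exp (2 * c ^ 2 * r₁ / ε)

/-- The step numbers `n₀`, `n₀ + N₁`, `n_ω` of the uniform bound: `n₀ ≥ 1` is past the time
`(γ₁² / ε + 8 ε / c²) ln (R² / ρ̂₀²)`, which is `T` below, at least the time `r` passes from step
`n₀` to step `n₀ + N₁`, and `r₁ = t^{n_ω} - t^{n₀ + N₁} > 0`. -/
def AdmissibleSteps (t : ℕ → ℝ) (T r : ℝ) (n₀ N₁ nω : ℕ) : Prop :=
  0 < n₀ ∧ T ≤ t n₀ ∧ r ≤ t (n₀ + N₁) - t n₀ ∧ 0 < t nω - t (n₀ + N₁)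

end

end CahnHilliard

/-! The proof is a uniform discrete Gronwall argument for `y n` $=|\omega^n|_1^2$; it needs growth
control of $y$ over one step and a bound for $\sum k_j\,y_{j+1}$ over time windows of length about
$r_1$.

Growth (`growth_le`, `y_le_exp`): subtracting two consecutive potential equations, testing with
$u^{n+1}-u^n$ and using $f'\ge -c$ gives $(1-x)^2 y_{n+1}\le y_n$ with
$x=c^2k_n/(4\varepsilon)<1/2$, hence at most exponential growth at rate $2c^2/\varepsilon$.

Sum (`sum_le`): the energy $J=\frac\varepsilon2|u|_1^2+\int F(u)$ dissipates $k_n y_{n+1}$ per step,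
up to an error $\frac{c^2}{8\varepsilon}k_n^2y_{n+1}$ due to the nonconvexity of $F$ (`energy_le`).
The dual norm balance (`dual_le`) pays for this error, since it contains the same $k_n^2y_{n+1}$.
The balance also makes $|\bar u^n|_{-1}$ enter an absorbing ball (`N_sq_le`) and, as $J$ decreases,
bounds $J$ after a further time $r$ (`energy_sum_le`). So the sum is bounded independently of $u_0$.

No operator $A^{-1}$ is constructed: the identity for $|\cdot|_{-1}^2$ comes from
$|v|_{-1}^2=\sup_\chi\,(2(v,\chi)-|\chi|_1^2)$ (`normNegOne_le_iff`). All that the PDE contributes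
is recorded in `Estimates`; the rest concerns real sequences. -/

namespace CahnHilliard

/-! ### Real sequences: absorbing ball, energy decay, uniform Gronwall. -/

/-- One step of the decay of a sequence with `(1 + 2hε/γ²) y ≤ x + 2hC`. -/
lemma exp_decay_step {ε c γ h C x y τ Q : ℝ} (hε : 0 < ε) (hc : 0 < c) (hγ : 0 < γ)
    (hh : 0 < h) (hhc : h < 2 * ε / c ^ 2) (hQ : 0 ≤ Q)
    (hstep : y + 2 * h * ε * (y / γ ^ 2) ≤ x + 2 * h * C)
    (hx : x ≤ C * γ ^ 2 / ε + Real.exp (-τ / (γ ^ 2 / (2 * ε) + 2 * ε / c ^ 2)) * Q) :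
    y ≤ C * γ ^ 2 / ε + Real.exp (-(τ + h) / (γ ^ 2 / (2 * ε) + 2 * ε / c ^ 2)) * Q := by
  set D := γ ^ 2 / (2 * ε) + 2 * ε / c ^ 2 with hD
  have hDpos : 0 < D := by positivity
  set s := 2 * h * ε / γ ^ 2 with hs
  have hspos : 0 < s := by positivity
  set e := Real.exp (-τ / D)
  have hsplit : Real.exp (-(τ + h) / D) = e * Real.exp (-(h / D)) := by
    rw [← Real.exp_add]; congr 1; ring
  -- The contraction factor is $1/(1+s)=1-h/(\gamma^2/(2\varepsilon)+h)$, and $h<2\varepsilon/c^2$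
  -- bounds this denominator by $D$. The recursion has the fixed point $C\gamma^2/\varepsilon$; only
  -- the distance above it decays.
  have hfac : 1 ≤ (1 + s) * Real.exp (-(h / D)) := by
    have h1 : 1 - h / D ≤ Real.exp (-(h / D)) := by
      have := Real.add_one_le_exp (-(h / D)); linarith
    have h2 : h / D * (1 + s) ≤ s := by
      rw [div_mul_eq_mul_div, div_le_iff₀ hDpos]
      have h3 : s * D = h * (1 + 2 * ε / γ ^ 2 * (2 * ε / c ^ 2)) := by
        rw [hs, hD]; field_simp
      have h4 : s = 2 * ε / γ ^ 2 * h := by rw [hs]; ring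
      rw [h3, h4]
      gcongr
    calc (1 : ℝ) ≤ (1 + s) * (1 - h / D) := by linarith
      _ ≤ _ := by gcongr
  have hC : 2 * h * C = s * (C * γ ^ 2 / ε) := by rw [hs]; field_simp
  have hy : 2 * h * ε * (y / γ ^ 2) = s * y := by rw [hs]; ring
  rw [hC, hy] at hstep
  rw [hsplit]
  have hepos : 0 ≤ e * Q := mul_nonneg (Real.exp_pos _).le hQ
  have h5 : (1 + s) * (y - C * γ ^ 2 / ε) ≤ (1 + s) * (e * Real.exp (-(h / D)) * Q) := by
    calc (1 + s) * (y - C * γ ^ 2 / ε) ≤ e * Q := by linarith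
      _ ≤ e * Q * ((1 + s) * Real.exp (-(h / D))) := le_mul_of_one_le_right hepos hfac
      _ = _ := by ring
  have := le_of_mul_le_mul_left h5 (by linarith)
  linarith

/-- The a priori estimates for the real sequences attached to a solution of the scheme:
`N n = |uⁿ - m(uⁿ)|₋₁`, `E n = |uⁿ|₁²`, `Φ n = ∫ F(uⁿ)` and `y n = |wⁿ|₁²`. -/
structure Estimates (ε c γ C₀ B R : ℝ) (t N E Φ y : ℕ → ℝ) : Prop where
  N_nonneg : ∀ n, 0 ≤ N n
  N_zero : N 0 ≤ R
  E_nonneg : ∀ n, 0 ≤ E n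
  y_nonneg : ∀ n, 0 ≤ y n
  Φ_lower : ∀ n, -B ≤ Φ (n + 1)
  N_le : ∀ n, N (n + 1) ^ 2 ≤ γ ^ 2 * E (n + 1)
  dual_step : ∀ n, N (n + 1) ^ 2 + (t (n + 1) - t n) ^ 2 * y (n + 1) +
    2 * (t (n + 1) - t n) * (ε * E (n + 1) + Φ (n + 1) - C₀) ≤ N n ^ 2
  energy_step : ∀ n, 1 ≤ n → ε / 2 * E (n + 1) + Φ (n + 1) + (t (n + 1) - t n) * y (n + 1) ≤
    ε / 2 * E n + Φ n + c ^ 2 / (8 * ε) * ((t (n + 1) - t n) ^ 2 * y (n + 1))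
  growth_step : ∀ n, 1 ≤ n → (1 - c ^ 2 * (t (n + 1) - t n) / (4 * ε)) ^ 2 * y (n + 1) ≤ y n

namespace Estimates

variable {ε c γ C₀ B R : ℝ} {t N E Φ y : ℕ → ℝ}

lemma N_sq_le_exp (h : Estimates ε c γ C₀ B R t N E Φ y) (hε : 0 < ε) (hc : 0 < c) (hγ : 0 < γ)
    (ht0 : t 0 = 0) (hmono : StrictMono t) (hstep : ∀ n, t (n + 1) - t n < 2 * ε / c ^ 2)
    (hC : 0 ≤ C₀ + B) (n : ℕ) :
    N n ^ 2 ≤ (C₀ + B) * γ ^ 2 / ε +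
      Real.exp (-t n / (γ ^ 2 / (2 * ε) + 2 * ε / c ^ 2)) * R ^ 2 := by
  induction n with
  | zero =>
    have h1 : N 0 ^ 2 ≤ R ^ 2 := pow_le_pow_left₀ (h.N_nonneg 0) h.N_zero 2
    have h2 : 0 ≤ (C₀ + B) * γ ^ 2 / ε := by positivity
    simp only [ht0, neg_zero, zero_div, Real.exp_zero, one_mul]
    linarith
  | succ n ih =>
    have hk : 0 < t (n + 1) - t n := sub_pos.2 (hmono n.lt_succ_self)
    have hds := h.dual_step n
    have hy : 0 ≤ (t (n + 1) - t n) ^ 2 * y (n + 1) :=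
      mul_nonneg (sq_nonneg _) (h.y_nonneg _)
    have hE : N (n + 1) ^ 2 / γ ^ 2 ≤ E (n + 1) := by
      rw [div_le_iff₀ (by positivity)]; linarith [h.N_le n]
    have h1 : ε * (N (n + 1) ^ 2 / γ ^ 2) - (C₀ + B) ≤ ε * E (n + 1) + Φ (n + 1) - C₀ := by
      have := mul_le_mul_of_nonneg_left hE hε.le
      linarith [h.Φ_lower n]
    have h2 := mul_le_mul_of_nonneg_left h1 (by linarith : 0 ≤ 2 * (t (n + 1) - t n))
    have h3 := exp_decay_step (C := C₀ + B) (y := N (n + 1) ^ 2) hε hc hγ hk (hstep n)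
      (sq_nonneg R) (by linarith) ih
    rwa [add_sub_cancel] at h3

lemma N_sq_le (h : Estimates ε c γ C₀ B R t N E Φ y) (hε : 0 < ε) (hc : 0 < c) (hγ : 0 < γ)
    (ht0 : t 0 = 0) (hmono : StrictMono t) (hstep : ∀ n, t (n + 1) - t n < 2 * ε / c ^ 2)
    (hC : 0 < C₀ + B) {ρ : ℝ} (hρ : ρ ^ 2 = 2 * (C₀ + B) * (γ ^ 2 / ε + 8 * ε / c ^ 2))
    {n : ℕ} (hn : (γ ^ 2 / ε + 8 * ε / c ^ 2) * Real.log (R ^ 2 / ρ ^ 2) ≤ t n) :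
    N n ^ 2 ≤ 2 * ρ ^ 2 := by
  have hρpos : 0 < ρ ^ 2 := by rw [hρ]; positivity
  set D := γ ^ 2 / (2 * ε) + 2 * ε / c ^ 2 with hD
  have hDpos : 0 < D := by positivity
  have hL : (C₀ + B) * γ ^ 2 / ε ≤ ρ ^ 2 := by
    have h1 : 0 ≤ (C₀ + B) * (γ ^ 2 / ε) := by positivity
    have h2 : 0 ≤ (C₀ + B) * (8 * ε / c ^ 2) := by positivity
    rw [hρ, mul_div_assoc]; linarith
  have htn : 0 ≤ t n := ht0 ▸ hmono.monotone n.zero_le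
  have hexp : Real.exp (-t n / D) * R ^ 2 ≤ ρ ^ 2 := by
    -- If $R\le|\rho|$ no waiting time is needed; this branch also covers $R=0$, where the logarithm
    -- has its default value $0$.
    rcases le_or_gt (R ^ 2) (ρ ^ 2) with hR | hR
    · have : Real.exp (-t n / D) ≤ 1 :=
        Real.exp_le_one_iff.2 (div_nonpos_of_nonpos_of_nonneg (by linarith) hDpos.le)
      exact (mul_le_of_le_one_left (sq_nonneg R) this).trans hR
    · have hRpos : 0 < R ^ 2 := hρpos.trans hR
      have hlog : 0 ≤ Real.log (R ^ 2 / ρ ^ 2) := Real.log_nonneg ((one_le_div hρpos).2 hR.le)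
      have hDle : D ≤ γ ^ 2 / ε + 8 * ε / c ^ 2 := by
        have h1 : γ ^ 2 / (2 * ε) = γ ^ 2 / ε / 2 := by field_simp
        have h2 : 0 ≤ γ ^ 2 / ε := by positivity
        have h3 : 2 * ε / c ^ 2 ≤ 8 * ε / c ^ 2 := by gcongr; norm_num
        rw [hD, h1]; linarith
      have h1 : D * Real.log (R ^ 2 / ρ ^ 2) ≤ t n :=
        (mul_le_mul_of_nonneg_right hDle hlog).trans hn
      have h2 : Real.log (R ^ 2 / ρ ^ 2) ≤ t n / D := by
        rw [le_div_iff₀ hDpos]; linarith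
      have h3 : Real.exp (-t n / D) ≤ ρ ^ 2 / R ^ 2 := by
        calc Real.exp (-t n / D) ≤ Real.exp (-Real.log (R ^ 2 / ρ ^ 2)) := by
              apply Real.exp_le_exp.2; rw [neg_div]; linarith
          _ = ρ ^ 2 / R ^ 2 := by
              rw [← Real.log_inv, inv_div, Real.exp_log (by positivity)]
      calc Real.exp (-t n / D) * R ^ 2 ≤ ρ ^ 2 / R ^ 2 * R ^ 2 := by gcongr
        _ = ρ ^ 2 := div_mul_cancel₀ _ hRpos.ne'
  linarith [h.N_sq_le_exp hε hc hγ ht0 hmono hstep hC.le n]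

lemma energy_antitone (h : Estimates ε c γ C₀ B R t N E Φ y) (hε : 0 < ε) (hc : 0 < c)
    (hmono : StrictMono t) (hstep : ∀ n, t (n + 1) - t n < 2 * ε / c ^ 2) {n : ℕ} (hn : 1 ≤ n) :
    ε / 2 * E (n + 1) + Φ (n + 1) ≤ ε / 2 * E n + Φ n := by
  have hk : 0 < t (n + 1) - t n := sub_pos.2 (hmono n.lt_succ_self)
  have h1 : c ^ 2 / (8 * ε) * ((t (n + 1) - t n) ^ 2 * y (n + 1)) ≤
      (t (n + 1) - t n) * y (n + 1) := by
    have h2 : c ^ 2 / (8 * ε) * (t (n + 1) - t n) ≤ 1 := by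
      rw [div_mul_eq_mul_div, div_le_one (by positivity)]
      have := (lt_div_iff₀ (by positivity)).1 (hstep n)
      linarith
    have h3 : 0 ≤ (t (n + 1) - t n) * y (n + 1) := mul_nonneg hk.le (h.y_nonneg _)
    calc _ = c ^ 2 / (8 * ε) * (t (n + 1) - t n) * ((t (n + 1) - t n) * y (n + 1)) := by ring
      _ ≤ _ := mul_le_of_le_one_left h3 h2
  linarith [h.energy_step n hn]

lemma energy_le_of_le (h : Estimates ε c γ C₀ B R t N E Φ y) (hε : 0 < ε) (hc : 0 < c)
    (hmono : StrictMono t) (hstep : ∀ n, t (n + 1) - t n < 2 * ε / c ^ 2) {m n : ℕ} (hm : 1 ≤ m)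
    (hmn : m ≤ n) : ε / 2 * E n + Φ n ≤ ε / 2 * E m + Φ m := by
  induction n, hmn using Nat.le_induction with
  | base => exact le_rfl
  | succ n hmn ih => exact (h.energy_antitone hε hc hmono hstep (hm.trans hmn)).trans ih

/-- Summing `dual_step` bounds the time integral of $J-C_0$; as $J$ is nonincreasing, its last value
is at most its time average. -/
lemma energy_sum_le (h : Estimates ε c γ C₀ B R t N E Φ y) (hε : 0 < ε) (hc : 0 < c)
    (hmono : StrictMono t) (hstep : ∀ n, t (n + 1) - t n < 2 * ε / c ^ 2) {m n : ℕ} (hm : 1 ≤ m)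
    (hmn : m ≤ n) :
    2 * (t n - t m) * (ε / 2 * E n + Φ n - C₀) + N n ^ 2 ≤ N m ^ 2 := by
  induction n, hmn using Nat.le_induction with
  | base => simp
  | succ n hmn ih =>
    have hk : 0 < t (n + 1) - t n := sub_pos.2 (hmono n.lt_succ_self)
    have htm : 0 ≤ t n - t m := sub_nonneg.2 (hmono.monotone hmn)
    have h1 := h.energy_antitone hε hc hmono hstep (hm.trans hmn)
    have h2 := mul_le_mul_of_nonneg_left h1 htm
    have h3 : 0 ≤ (t (n + 1) - t n) ^ 2 * y (n + 1) := mul_nonneg (sq_nonneg _) (h.y_nonneg _)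
    have h4 : 0 ≤ (t (n + 1) - t n) * (ε * E (n + 1)) :=
      mul_nonneg hk.le (mul_nonneg hε.le (h.E_nonneg _))
    have h5 := h.dual_step n
    linarith

/-- Both `energy_step` and `dual_step` telescope; the second absorbs the error term of the first. -/
lemma sum_le (h : Estimates ε c γ C₀ B R t N E Φ y) (hε : 0 < ε) {m n : ℕ} (hm : 1 ≤ m)
    (hmono : StrictMono t) (hmn : m ≤ n) :
    ∑ j ∈ Finset.Ico m n, (t (j + 1) - t j) * y (j + 1) ≤
      (ε / 2 * E m + Φ m) - (ε / 2 * E n + Φ n) +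
        c ^ 2 / (8 * ε) * (N m ^ 2 - N n ^ 2 + 2 * (C₀ + B) * (t n - t m)) := by
  induction n, hmn using Nat.le_induction with
  | base => simp
  | succ n hmn ih =>
    rw [Finset.sum_Ico_succ_top hmn]
    have hk : 0 < t (n + 1) - t n := sub_pos.2 (hmono n.lt_succ_self)
    have h1 := h.energy_step n (hm.trans hmn)
    have h2 : (t (n + 1) - t n) ^ 2 * y (n + 1) ≤
        N n ^ 2 - N (n + 1) ^ 2 + 2 * (C₀ + B) * (t (n + 1) - t n) := by
      have h3 : -(C₀ + B) ≤ ε * E (n + 1) + Φ (n + 1) - C₀ := by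
        have := mul_nonneg hε.le (h.E_nonneg (n + 1))
        linarith [h.Φ_lower n]
      have h4 := mul_le_mul_of_nonneg_left h3 (by linarith : 0 ≤ 2 * (t (n + 1) - t n))
      linarith [h.dual_step n]
    have h5 := mul_le_mul_of_nonneg_left h2 (by positivity : 0 ≤ c ^ 2 / (8 * ε))
    linarith

lemma y_le_exp (h : Estimates ε c γ C₀ B R t N E Φ y) (hε : 0 < ε) (hc : 0 < c)
    (hmono : StrictMono t) (hstep : ∀ n, t (n + 1) - t n < 2 * ε / c ^ 2) {m n : ℕ} (hm : 1 ≤ m)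
    (hmn : m ≤ n) : y n ≤ y m * Real.exp (2 * c ^ 2 * (t n - t m) / ε) := by
  induction n, hmn using Nat.le_induction with
  | base => simp
  | succ n hmn ih =>
    have hk : 0 < t (n + 1) - t n := sub_pos.2 (hmono n.lt_succ_self)
    set x := c ^ 2 * (t (n + 1) - t n) / (4 * ε) with hx
    have hxpos : 0 < x := by positivity
    have hxle : x ≤ 1 / 2 := by
      rw [hx, div_le_iff₀ (by positivity)]
      have := (lt_div_iff₀ (by positivity)).1 (hstep n)
      linarith
    -- $(1-x)(1+4x)\ge1$ for $0\le x\le 3/4$. Squared, it gives $e^{8x}$, and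
    -- $8x=2c^2k_n/\varepsilon$ is the rate in the statement.
    have h1 : 1 ≤ (1 - x) * Real.exp (4 * x) := by
      have h2 := Real.add_one_le_exp (4 * x)
      calc 1 ≤ (1 - x) * (4 * x + 1) := by nlinarith
        _ ≤ _ := by gcongr; linarith
    have h3 : 1 ≤ (1 - x) ^ 2 * Real.exp (8 * x) := by
      have := one_le_pow₀ h1 (n := 2)
      rwa [mul_pow, ← Real.exp_nat_mul, ← mul_assoc, show ((2 : ℕ) : ℝ) * 4 = 8 by norm_num]
        at this
    have h4 : Real.exp (2 * c ^ 2 * (t (n + 1) - t m) / ε) =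
        Real.exp (2 * c ^ 2 * (t n - t m) / ε) * Real.exp (8 * x) := by
      rw [← Real.exp_add, hx]; congr 1; field_simp; ring
    have hy := h.y_nonneg (n + 1)
    calc y (n + 1) ≤ y (n + 1) * ((1 - x) ^ 2 * Real.exp (8 * x)) :=
          le_mul_of_one_le_right hy h3
      _ = (1 - x) ^ 2 * y (n + 1) * Real.exp (8 * x) := by ring
      _ ≤ y n * Real.exp (8 * x) := by gcongr; exact h.growth_step n (hm.trans hmn)
      _ ≤ y m * Real.exp (2 * c ^ 2 * (t n - t m) / ε) * Real.exp (8 * x) := by gcongr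
      _ = _ := by rw [h4]; ring

/-- The uniform discrete Gronwall argument on the window `[tⁿ - r₁, tⁿ]`. -/
lemma y_le (h : Estimates ε c γ C₀ B R t N E Φ y) (hε : 0 < ε) (hc : 0 < c) (hγ : 0 < γ)
    (ht0 : t 0 = 0) (hmono : StrictMono t) (hstep : ∀ n, t (n + 1) - t n < 2 * ε / c ^ 2)
    (hC₀ : 0 ≤ C₀) (hC : 0 < C₀ + B) {ρ r : ℝ} (hr : 0 < r)
    (hρ : ρ ^ 2 = 2 * (C₀ + B) * (γ ^ 2 / ε + 8 * ε / c ^ 2)) {n₀ M nω n : ℕ} (hn₀ : 1 ≤ n₀)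
    (hT : (γ ^ 2 / ε + 8 * ε / c ^ 2) * Real.log (R ^ 2 / ρ ^ 2) ≤ t n₀)
    (hM : n₀ ≤ M) (hrM : r ≤ t M - t n₀) (hω : 0 < t nω - t M) (hn : nω ≤ n) :
    y n ≤ (c ^ 2 / (4 * ε) * (C₀ + B) + c ^ 2 * (2 * ρ) ^ 2 / (8 * ε * (t nω - t M)) +
      (C₀ + (2 * ρ) ^ 2 / (2 * r)) / (t nω - t M)) *
        Real.exp (2 * c ^ 2 * (t nω - t M) / ε) := by
  set r₁ := t nω - t M with hr₁
  set s := t n - r₁ with hs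
  have hN : ∀ i, n₀ ≤ i → N i ^ 2 ≤ 2 * ρ ^ 2 := fun i hi =>
    h.N_sq_le hε hc hγ ht0 hmono hstep hC hρ (hT.trans (hmono.monotone hi))
  have hMs : t M ≤ s := by have := hmono.monotone hn; rw [hs, hr₁]; linarith
  have hsn : s < t n := by rw [hs]; linarith
  -- The left end $s$ of the window need not be a mesh point; $[t^m,t^{m+1})$ is the mesh interval
  -- that contains it.
  obtain ⟨m, hms, hsm⟩ : ∃ m, t m ≤ s ∧ s < t (m + 1) := by
    have hex : ∃ i, s < t i := ⟨n, hsn⟩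
    classical
    have h0 : Nat.find hex ≠ 0 := fun h0 => by
      have := Nat.find_spec hex
      rw [h0] at this
      exact absurd (hMs.trans_lt this) (not_lt.2 (hmono.monotone M.zero_le))
    obtain ⟨m, hm⟩ := Nat.exists_eq_succ_of_ne_zero h0
    exact ⟨m, not_lt.1 (Nat.find_min hex (by omega)), by
      have := Nat.find_spec hex; rwa [hm] at this⟩
  have hMm : M ≤ m := Nat.lt_succ_iff.1 (hmono.lt_iff_lt.1 (hMs.trans_lt hsm))
  have hmn : m + 1 ≤ n := hmono.lt_iff_lt.1 (hms.trans_lt hsn)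
  have hM1 : 1 ≤ M := hn₀.trans hM
  -- By `y_le_exp`, $q$ is a lower bound for $y$ at all mesh points in $(s,t^n]$.
  set q := y n * Real.exp (-(2 * c ^ 2 * r₁ / ε)) with hq
  have hqy : ∀ j, m ≤ j → j + 1 ≤ n → q ≤ y (j + 1) := by
    intro j hj hjn
    have h1 := h.y_le_exp hε hc hmono hstep (Nat.le_add_left 1 j) hjn
    have h2 : t n - t (j + 1) ≤ r₁ := by
      have := hmono.monotone (Nat.succ_le_succ hj)
      simp only [Nat.succ_eq_add_one] at this
      linarith
    have h3 : y n ≤ y (j + 1) * Real.exp (2 * c ^ 2 * r₁ / ε) := by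
      refine h1.trans (mul_le_mul_of_nonneg_left (Real.exp_le_exp.2 ?_) (h.y_nonneg _))
      gcongr
    rw [hq, Real.exp_neg, ← div_eq_mul_inv, div_le_iff₀ (Real.exp_pos _)]
    exact h3
  have hq0 : 0 ≤ q := mul_nonneg (h.y_nonneg n) (Real.exp_pos _).le
  -- The first interval counts only from $s$ on, so that at $i=n$ the left side is exactly $r_1q$.
  have hsum : ∀ i, m + 1 ≤ i → i ≤ n →
      (t i - s) * q ≤ ∑ j ∈ Finset.Ico m i, (t (j + 1) - t j) * y (j + 1) := by
    intro i hi
    induction i, hi using Nat.le_induction with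
    | base =>
      intro hi
      rw [Finset.sum_Ico_succ_top le_rfl, Finset.Ico_self, Finset.sum_empty, zero_add]
      calc (t (m + 1) - s) * q ≤ (t (m + 1) - t m) * q := by gcongr
        _ ≤ _ := mul_le_mul_of_nonneg_left (hqy m le_rfl hi)
          (sub_nonneg.2 (hmono.monotone m.le_succ))
    | succ i hi ih =>
      intro hin
      rw [Finset.sum_Ico_succ_top (by omega)]
      have h1 := ih (by omega)
      have h2 := mul_le_mul_of_nonneg_left (hqy i (by omega) hin)
        (sub_nonneg.2 (hmono.monotone i.le_succ) : 0 ≤ t (i + 1) - t i)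
      linarith
  have hS := (hsum n hmn le_rfl).trans
    (h.sum_le (c := c) hε (hM1.trans hMm) hmono (m.le_succ.trans hmn))
  have hJm : ε / 2 * E m + Φ m ≤ C₀ + (2 * ρ) ^ 2 / (2 * r) := by
    refine (h.energy_le_of_le hε hc hmono hstep hM1 hMm).trans ?_
    have h1 := h.energy_sum_le hε hc hmono hstep hn₀ hM
    have h2 := hN n₀ le_rfl
    have h3 : 0 ≤ (2 * ρ) ^ 2 / (2 * r) := by positivity
    rcases le_or_gt (ε / 2 * E M + Φ M - C₀) 0 with h4 | h4
    · linarith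
    · have h5 := mul_le_mul_of_nonneg_right hrM h4.le
      have h6 : ε / 2 * E M + Φ M - C₀ ≤ (2 * ρ) ^ 2 / (2 * r) := by
        rw [le_div_iff₀ (by positivity)]
        nlinarith [sq_nonneg (N M), sq_nonneg ρ]
      linarith
  have hJn : -B ≤ ε / 2 * E n + Φ n := by
    obtain ⟨i, rfl⟩ := Nat.exists_eq_add_of_le' ((Nat.le_add_left 1 m).trans hmn)
    have := mul_nonneg hε.le (h.E_nonneg (i + 1))
    linarith [h.Φ_lower i]
  have hNm := hN m (hM.trans hMm)
  have hlen : t n - t m ≤ r₁ + 2 * ε / c ^ 2 := by have := hstep m; linarith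
  have hbr : N m ^ 2 - N n ^ 2 + 2 * (C₀ + B) * (t n - t m) ≤
      2 * ρ ^ 2 + 2 * (C₀ + B) * (r₁ + 2 * ε / c ^ 2) := by
    have := mul_le_mul_of_nonneg_left hlen (by linarith : 0 ≤ 2 * (C₀ + B))
    linarith [sq_nonneg (N n)]
  have hbr' := mul_le_mul_of_nonneg_left hbr (by positivity : 0 ≤ c ^ 2 / (8 * ε))
  -- Half of the term with $(2\rho)^2$ bounds $N_m^2\le2\rho^2$. The other half is at least
  -- $4(C_0+B)$, because of $8\varepsilon/c^2$ in $\rho^2$; it absorbs the lower energy bound $-B$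
  -- and the excess $(C_0+B)/2$ from one extra step of length $2\varepsilon/c^2$.
  have hslack : B + c ^ 2 / (8 * ε) * (2 * ρ ^ 2 + 2 * (C₀ + B) * (r₁ + 2 * ε / c ^ 2)) ≤
      c ^ 2 / (4 * ε) * (C₀ + B) * r₁ + c ^ 2 * (2 * ρ) ^ 2 / (8 * ε) := by
    have h1 : c ^ 2 / (8 * ε) * (2 * ρ ^ 2 + 2 * (C₀ + B) * (r₁ + 2 * ε / c ^ 2)) =
        c ^ 2 / (8 * ε) * (2 * ρ ^ 2) + c ^ 2 / (4 * ε) * (C₀ + B) * r₁ + (C₀ + B) / 2 := by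
      field_simp; ring
    have h2 : c ^ 2 * (2 * ρ) ^ 2 / (8 * ε) =
        c ^ 2 / (8 * ε) * (2 * ρ ^ 2) + c ^ 2 / (8 * ε) * (2 * ρ ^ 2) := by ring
    have h3 : c ^ 2 / (8 * ε) * (2 * ρ ^ 2) =
        4 * (C₀ + B) + (C₀ + B) * c ^ 2 * γ ^ 2 / (2 * ε ^ 2) := by
      rw [hρ]; field_simp; ring
    have h4 : 0 ≤ (C₀ + B) * c ^ 2 * γ ^ 2 / (2 * ε ^ 2) := by positivity
    rw [h1, h2, h3]; linarith
  have htot : q * r₁ ≤ c ^ 2 / (4 * ε) * (C₀ + B) * r₁ + c ^ 2 * (2 * ρ) ^ 2 / (8 * ε) +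
      (C₀ + (2 * ρ) ^ 2 / (2 * r)) := by
    have h1 : (t n - s) * q = q * r₁ := by rw [hs]; ring
    rw [h1] at hS
    linarith
  have hq' : q ≤ c ^ 2 / (4 * ε) * (C₀ + B) + c ^ 2 * (2 * ρ) ^ 2 / (8 * ε * r₁) +
      (C₀ + (2 * ρ) ^ 2 / (2 * r)) / r₁ := by
    rw [← mul_le_mul_iff_left₀ hω]
    refine htot.trans (le_of_eq ?_)
    have e1 : (C₀ + (2 * ρ) ^ 2 / (2 * r)) / r₁ * r₁ = C₀ + (2 * ρ) ^ 2 / (2 * r) :=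
      div_mul_cancel₀ _ hω.ne'
    have e2 : c ^ 2 * (2 * ρ) ^ 2 / (8 * ε * r₁) * r₁ = c ^ 2 * (2 * ρ) ^ 2 / (8 * ε) := by
      rw [← div_div]; exact div_mul_cancel₀ _ hω.ne'
    rw [add_mul, add_mul, e1, e2]
  have hyq : y n = q * Real.exp (2 * c ^ 2 * r₁ / ε) := by
    rw [hq, mul_assoc, ← Real.exp_add, neg_add_cancel, Real.exp_zero, mul_one]
  rw [hyq]
  gcongr

end Estimates

end CahnHilliard

/-! ### Function spaces: weak derivatives, form domain, dual norm. -/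

namespace CahnHilliard

variable {d : ℕ} {bc : BoundaryCondition} {Ω : Set (Space d)}

lemma IsAdmissibleDomain.isOpen (h : IsAdmissibleDomain bc Ω) : IsOpen Ω := by
  cases bc with
  | neumann => exact h.1
  | periodic L =>
    rw [h.2, ofPred_forall]
    exact isOpen_iInter_of_finite fun i => isOpen_Ioo.preimage (by fun_prop)

lemma IsAdmissibleDomain.nonempty (h : IsAdmissibleDomain bc Ω) : Ω.Nonempty := by
  cases bc with
  | neumann => exact h.2.1.nonempty
  | periodic L =>
    rw [h.2]
    exact ⟨WithLp.toLp 2 fun _ => L / 2, fun i => ⟨half_pos h.1, half_lt_self h.1⟩⟩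

lemma IsAdmissibleDomain.isBounded (h : IsAdmissibleDomain bc Ω) : Bornology.IsBounded Ω := by
  cases bc with
  | neumann => exact h.2.2.1
  | periodic L =>
    rw [h.2]
    refine (Metric.isBounded_closedBall (x := (0 : Space d))
      (r := Real.sqrt (∑ _ : Fin d, L ^ 2))).subset fun x hx => ?_
    rw [mem_closedBall_zero_iff, EuclideanSpace.norm_eq]
    refine Real.sqrt_le_sqrt (Finset.sum_le_sum fun i _ => ?_)
    rw [Real.norm_eq_abs, sq_abs]
    exact pow_le_pow_left₀ (hx i).1.le (hx i).2.le 2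

lemma IsAdmissibleDomain.isFiniteMeasure (h : IsAdmissibleDomain bc Ω) :
    IsFiniteMeasure (volume.restrict Ω) :=
  isFiniteMeasure_restrict.2 h.isBounded.measure_lt_top.ne

lemma IsAdmissibleDomain.volume_real_pos (h : IsAdmissibleDomain bc Ω) : 0 < volume.real Ω :=
  ENNReal.toReal_pos (h.isOpen.measure_pos volume h.nonempty).ne' h.isBounded.measure_lt_top.ne

section L2

/-- The combination $v+a\chi$ is the only linear operation used: it covers differences, removal of
the mean and multiples. -/
lemma MemL2.add_smul {v χ : Space d → ℝ} (hv : MemL2 Ω v) (hχ : MemL2 Ω χ) (a : ℝ) :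
    MemL2 Ω fun x => v x + a * χ x :=
  MemLp.add hv (hχ.const_mul a)

lemma MemL2.const (h : IsAdmissibleDomain bc Ω) (a : ℝ) : MemL2 Ω fun _ => a :=
  have := h.isFiniteMeasure
  memLp_const a

lemma MemL2.integrable (h : IsAdmissibleDomain bc Ω) {v : Space d → ℝ} (hv : MemL2 Ω v) :
    Integrable v (volume.restrict Ω) :=
  have := h.isFiniteMeasure
  MemLp.integrable (q := 2) (by norm_num) hv

lemma MemL2.integrable_mul {v χ : Space d → ℝ} (hv : MemL2 Ω v) (hχ : MemL2 Ω χ) :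
    Integrable (fun x => v x * χ x) (volume.restrict Ω) :=
  MemLp.integrable_mul hv hχ

lemma MemL2.of_continuous (h : IsAdmissibleDomain bc Ω) {φ : Space d → ℝ} (hφ : Continuous φ) :
    MemL2 Ω φ := by
  have := h.isFiniteMeasure
  obtain ⟨C, hC⟩ := h.isBounded.isCompact_closure.exists_bound_of_continuousOn hφ.continuousOn
  refine MemLp.of_bound hφ.aestronglyMeasurable C ?_
  filter_upwards [ae_restrict_mem h.isOpen.measurableSet] with x hx
  exact hC x (subset_closure hx)

lemma innerL2_add_smul_right {v χ η : Space d → ℝ} (hv : MemL2 Ω v) (hχ : MemL2 Ω χ)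
    (hη : MemL2 Ω η) (a : ℝ) :
    innerL2 Ω v (fun x => χ x + a * η x) = innerL2 Ω v χ + a * innerL2 Ω v η := by
  unfold innerL2
  rw [← integral_const_mul, ← integral_add (hv.integrable_mul hχ)
    ((hv.integrable_mul hη).const_mul a)]
  congr 1; ext x; ring

lemma innerL2_comm (v χ : Space d → ℝ) : innerL2 Ω v χ = innerL2 Ω χ v := by
  unfold innerL2; congr 1; ext x; ring

lemma innerL2_add_smul_left {v χ η : Space d → ℝ} (hv : MemL2 Ω v) (hχ : MemL2 Ω χ)
    (hη : MemL2 Ω η) (a : ℝ) :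
    innerL2 Ω (fun x => χ x + a * η x) v = innerL2 Ω χ v + a * innerL2 Ω η v := by
  rw [innerL2_comm, innerL2_add_smul_right hv hχ hη, innerL2_comm v χ, innerL2_comm v η]

lemma innerL2_congr_left {v v' : Space d → ℝ} (χ : Space d → ℝ)
    (h : ∀ᵐ x ∂(volume.restrict Ω), v x = v' x) : innerL2 Ω v χ = innerL2 Ω v' χ := by
  refine integral_congr_ae ?_
  filter_upwards [h] with x hx
  rw [hx]

end L2

section WeakPartial

lemma IsWeakPartial.ae_eq (h : IsAdmissibleDomain bc Ω) {i : Fin d} {v g g' : Space d → ℝ}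
    (hg : MemL2 Ω g) (hg' : MemL2 Ω g') (hv : IsWeakPartial Ω i v g)
    (hv' : IsWeakPartial Ω i v g') : g =ᵐ[volume.restrict Ω] g' := by
  have hint : Integrable (fun x => g x - g' x) (volume.restrict Ω) :=
    (hg.integrable h).sub (hg'.integrable h)
  have key := h.isOpen.ae_eq_zero_of_integral_contDiff_smul_eq_zero (μ := volume)
    (f := fun x => g x - g' x) (IntegrableOn.locallyIntegrableOn hint) (fun φ hφ hc hs => by
      have h1 := hv φ hφ hc hs
      rw [hv' φ hφ hc hs] at h1
      have hφ2 : MemL2 Ω φ := MemL2.of_continuous h hφ.continuous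
      have h2 : ∫ x in Ω, φ x • (g x - g' x) = 0 := by
        simp_rw [smul_eq_mul, mul_sub]
        rw [integral_sub (hφ2.integrable_mul hg) (hφ2.integrable_mul hg')]
        simp_rw [mul_comm (φ _)]
        linarith
      rw [← h2, setIntegral_eq_integral_of_forall_compl_eq_zero]
      intro x hx
      rw [image_eq_zero_of_notMem_tsupport fun hx' => hx (hs hx'), zero_smul])
  rw [EventuallyEq, ae_restrict_iff' h.isOpen.measurableSet]
  filter_upwards [key] with x hx hxΩ
  linarith [hx hxΩ]

lemma weakPartial_spec {i : Fin d} {v : Space d → ℝ}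
    (hv : ∃ g, MemL2 Ω g ∧ IsWeakPartial Ω i v g) :
    MemL2 Ω (weakPartial Ω i v) ∧ IsWeakPartial Ω i v (weakPartial Ω i v) := by
  unfold weakPartial
  rw [dif_pos hv]
  exact hv.choose_spec

lemma weakPartial_ae_eq (h : IsAdmissibleDomain bc Ω) {i : Fin d} {v g : Space d → ℝ}
    (hg : MemL2 Ω g) (hv : IsWeakPartial Ω i v g) :
    weakPartial Ω i v =ᵐ[volume.restrict Ω] g :=
  have hs := weakPartial_spec ⟨g, hg, hv⟩
  IsWeakPartial.ae_eq h hs.1 hg hs.2 hv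

lemma MemH1.memL2_weakPartial {v : Space d → ℝ} (hv : MemH1 Ω v) (i : Fin d) :
    MemL2 Ω (weakPartial Ω i v) := (weakPartial_spec (hv.2 i)).1

lemma MemH1.isWeakPartial {v : Space d → ℝ} (hv : MemH1 Ω v) (i : Fin d) :
    IsWeakPartial Ω i v (weakPartial Ω i v) := (weakPartial_spec (hv.2 i)).2

lemma continuous_fderiv_apply {φ : Space d → ℝ} (hφ : ContDiff ℝ ∞ φ) (e : Space d) :
    Continuous fun x => fderiv ℝ φ x e :=
  (hφ.continuous_fderiv (by simp)).clm_apply continuous_const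

lemma IsWeakPartial.add_smul (h : IsAdmissibleDomain bc Ω) {i : Fin d} {v χ g k : Space d → ℝ}
    (hv : MemL2 Ω v) (hχ : MemL2 Ω χ) (hg : MemL2 Ω g) (hk : MemL2 Ω k)
    (hvg : IsWeakPartial Ω i v g) (hχk : IsWeakPartial Ω i χ k) (a : ℝ) :
    IsWeakPartial Ω i (fun x => v x + a * χ x) (fun x => g x + a * k x) := by
  intro φ hφ hc hs
  have h1 := innerL2_add_smul_left (MemL2.of_continuous h (continuous_fderiv_apply hφ (unitVec i)))
    hv hχ a
  have h2 := innerL2_add_smul_left (MemL2.of_continuous h hφ.continuous) hg hk a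
  have h3 := hvg φ hφ hc hs
  have h4 := hχk φ hφ hc hs
  unfold innerL2 at h1 h2
  rw [h1, h2, h3, h4]; ring

lemma weakPartial_add_smul (h : IsAdmissibleDomain bc Ω) {v χ : Space d → ℝ} (hv : MemH1 Ω v)
    (hχ : MemH1 Ω χ) (a : ℝ) (i : Fin d) :
    weakPartial Ω i (fun x => v x + a * χ x) =ᵐ[volume.restrict Ω]
      fun x => weakPartial Ω i v x + a * weakPartial Ω i χ x :=
  weakPartial_ae_eq h ((hv.memL2_weakPartial i).add_smul (hχ.memL2_weakPartial i) a)
    (IsWeakPartial.add_smul h hv.1 hχ.1 (hv.memL2_weakPartial i) (hχ.memL2_weakPartial i)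
      (hv.isWeakPartial i) (hχ.isWeakPartial i) a)

lemma MemH1.add_smul (h : IsAdmissibleDomain bc Ω) {v χ : Space d → ℝ} (hv : MemH1 Ω v)
    (hχ : MemH1 Ω χ) (a : ℝ) : MemH1 Ω fun x => v x + a * χ x :=
  ⟨hv.1.add_smul hχ.1 a, fun i => ⟨_,
    (hv.memL2_weakPartial i).add_smul (hχ.memL2_weakPartial i) a,
    IsWeakPartial.add_smul h hv.1 hχ.1 (hv.memL2_weakPartial i) (hχ.memL2_weakPartial i)
      (hv.isWeakPartial i) (hχ.isWeakPartial i) a⟩⟩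

lemma isWeakPartial_const (a : ℝ) (i : Fin d) :
    IsWeakPartial Ω i (fun _ => a) 0 := by
  intro φ hφ hc hs
  have hzero : ∀ x, x ∉ Ω → fderiv ℝ φ x (unitVec i) = 0 := fun x hx => by
    rw [image_eq_zero_of_notMem_tsupport fun hx' => hx (hs (tsupport_fderiv_subset ℝ hx'))]
    rfl
  have hi : Integrable (fun x => fderiv ℝ φ x (unitVec i)) :=
    (continuous_fderiv_apply hφ _).integrable_of_hasCompactSupport (hc.fderiv_apply ℝ _)
  have h0 := integral_mul_fderiv_eq_neg_fderiv_mul_of_integrable (μ := volume) (𝕜 := ℝ)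
    (f := fun _ : Space d => (1 : ℝ)) (g := φ) (v := unitVec i) (by simp) (by simpa using hi)
    (by simpa using hφ.continuous.integrable_of_hasCompactSupport hc)
    (fun x _ => differentiableAt_const _)
    (fun x _ => (hφ.differentiable (by simp)).differentiableAt)
  rw [integral_const_mul, setIntegral_eq_integral_of_forall_compl_eq_zero hzero]
  simp at h0
  simp [h0]

/-- The integral over the cube of a partial derivative of a smooth periodic function vanishes. -/
lemma integral_fderiv_periodic {L : ℝ} (hL : 0 < L) {φ : Space d → ℝ} (hφ : ContDiff ℝ ∞ φ)
    (hper : ∀ i x, φ (x + L • unitVec i) = φ x) (i : Fin d) :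
    ∫ x in {x : Space d | ∀ i, x i ∈ Ioo 0 L}, fderiv ℝ φ x (unitVec i) = 0 := by
  obtain ⟨n, rfl⟩ : ∃ n, d = n + 1 := ⟨d - 1, by have := i.pos; omega⟩
  have hpre : {x : Space (n + 1) | ∀ i, x i ∈ Ioo 0 L} =
      (WithLp.ofLp : Space (n + 1) → Fin (n + 1) → ℝ) ⁻¹' (univ.pi fun _ => Ioo 0 L) := by
    ext x; simp
  set T : (Fin (n + 1) → ℝ) →L[ℝ] Space (n + 1) :=
    (EuclideanSpace.equiv (Fin (n + 1)) ℝ).symm.toContinuousLinearMap with hT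
  have hTe : ∀ j, T (Pi.single j 1) = unitVec j := fun j => rfl
  set G : (Fin (n + 1) → ℝ) → ℝ := fun x => fderiv ℝ φ (T x) (unitVec i) with hG
  have hGc : Continuous G := (continuous_fderiv_apply hφ _).comp T.continuous
  have hG' : ∀ x : Space (n + 1), fderiv ℝ φ x (unitVec i) = G (WithLp.ofLp x) := fun x => rfl
  simp_rw [hpre, hG']
  rw [(PiLp.volume_preserving_ofLp (Fin (n + 1))).setIntegral_preimage_emb
    (MeasurableEquiv.toLp 2 (Fin (n + 1) → ℝ)).symm.measurableEmbedding G,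
    volume_pi, setIntegral_congr_set Measure.univ_pi_Ioo_ae_eq_Icc, ← volume_pi]
  -- The divergence theorem is applied to the field $\varphi e_i$, whose divergence is
  -- $\partial_i\varphi$.
  have hsum : ∀ x, ∑ j, ((fderiv ℝ φ (T x)).comp T).smulRight (Pi.single i (1 : ℝ))
      (Pi.single j 1) j = G x := fun x => by
    rw [Finset.sum_eq_single i]
    · simp [hTe, hG]
    · intro j _ hj
      simp [Pi.single_eq_of_ne hj]
    · simp
  have hdiff : Differentiable ℝ φ := hφ.differentiable (by simp)
  have hdiv := integral_divergence_of_hasFDerivAt_off_countable (n := n) (E := ℝ)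
    (a := fun _ => 0) (b := fun _ => L) (fun _ => hL.le)
    (fun x => φ (T x) • Pi.single i (1 : ℝ))
    (fun x => ((fderiv ℝ φ (T x)).comp T).smulRight (Pi.single i (1 : ℝ))) ∅ countable_empty
    (Continuous.continuousOn (by have := hφ.continuous; fun_prop))
    (fun x _ => ((hdiff (T x)).hasFDerivAt.comp x T.hasFDerivAt).smul_const _)
    (by simp_rw [hsum]; exact hGc.continuousOn.integrableOn_compact isCompact_Icc)
  simp_rw [hsum] at hdiv
  rw [hdiv]
  refine Finset.sum_eq_zero fun j _ => ?_
  -- Only the faces orthogonal to $e_i$ carry flux, and by periodicity these two cancel.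
  rcases eq_or_ne j i with rfl | hj
  · rw [sub_eq_zero]
    congr 1; ext x
    have hins : T (j.insertNth L x) = T (j.insertNth 0 x) + L • unitVec j := by
      rw [← hTe, ← map_smul, ← map_add]
      congr 1
      ext l
      refine Fin.succAboveCases j ?_ (fun l => ?_) l <;> simp
    simp [hins, hper]
  · simp [Pi.single_eq_of_ne hj]

lemma weakPartial_const (h : IsAdmissibleDomain bc Ω) (a : ℝ) (i : Fin d) :
    weakPartial Ω i (fun _ => a) =ᵐ[volume.restrict Ω] 0 :=
  weakPartial_ae_eq h (MemL2.const h 0) (isWeakPartial_const a i)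

end WeakPartial

section FormDomain

lemma FormDomain.memH1 {v : Space d → ℝ} (hv : FormDomain bc Ω v) : MemH1 Ω v := by
  cases bc with
  | neumann => exact hv
  | periodic L => exact hv.1

lemma FormDomain.add_smul (h : IsAdmissibleDomain bc Ω) {v χ : Space d → ℝ}
    (hv : FormDomain bc Ω v) (hχ : FormDomain bc Ω χ) (a : ℝ) :
    FormDomain bc Ω fun x => v x + a * χ x := by
  cases bc with
  | neumann => exact MemH1.add_smul h hv hχ a
  | periodic L =>
    refine ⟨hv.1.add_smul h hχ.1 a, fun φ hφ hper i => ?_⟩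
    have h1 := innerL2_add_smul_left
      (MemL2.of_continuous h (continuous_fderiv_apply hφ (unitVec i))) hv.1.1 hχ.1.1 a
    have h2 := innerL2_add_smul_left (MemL2.of_continuous h hφ.continuous)
      (hv.1.memL2_weakPartial i) (hχ.1.memL2_weakPartial i) a
    have h3 := innerL2_congr_left φ (weakPartial_add_smul h hv.1 hχ.1 a i)
    have h4 := hv.2 φ hφ hper i
    have h5 := hχ.2 φ hφ hper i
    unfold innerL2 at h1 h2 h3
    rw [h1, h3, h2, h4, h5]; ring

lemma FormDomain.const (h : IsAdmissibleDomain bc Ω) (a : ℝ) : FormDomain bc Ω fun _ => a := by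
  have hH1 : MemH1 Ω fun _ : Space d => a :=
    ⟨MemL2.const h a, fun i => ⟨0, MemL2.const h 0, isWeakPartial_const a i⟩⟩
  cases bc with
  | neumann => exact hH1
  | periodic L =>
    refine ⟨hH1, fun φ hφ hper i => ?_⟩
    have h1 := innerL2_congr_left φ (weakPartial_const h a i)
    unfold innerL2 at h1
    rw [h1, integral_const_mul, h.2, integral_fderiv_periodic h.1 hφ hper i]
    simp

lemma gradInner_comm (v χ : Space d → ℝ) : gradInner Ω v χ = gradInner Ω χ v := by
  unfold gradInner; congr 1; ext x; congr 1; ext i; ring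

lemma gradInner_self_nonneg (v : Space d → ℝ) : 0 ≤ gradInner Ω v v :=
  integral_nonneg fun _ => Finset.sum_nonneg fun _ _ => mul_self_nonneg _

lemma MemH1.integrable_gradInner {v χ : Space d → ℝ} (hv : MemH1 Ω v) (hχ : MemH1 Ω χ) :
    Integrable (fun x => ∑ i, weakPartial Ω i v x * weakPartial Ω i χ x)
      (volume.restrict Ω) :=
  integrable_finsetSum _ fun i _ =>
    (hv.memL2_weakPartial i).integrable_mul (hχ.memL2_weakPartial i)

lemma gradInner_add_smul_right (h : IsAdmissibleDomain bc Ω) {v χ η : Space d → ℝ}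
    (hv : MemH1 Ω v) (hχ : MemH1 Ω χ) (hη : MemH1 Ω η) (a : ℝ) :
    gradInner Ω v (fun x => χ x + a * η x) = gradInner Ω v χ + a * gradInner Ω v η := by
  unfold gradInner
  rw [← integral_const_mul, ← integral_add (hv.integrable_gradInner hχ)
    ((hv.integrable_gradInner hη).const_mul a)]
  refine integral_congr_ae ?_
  filter_upwards [eventually_all.2 fun i => weakPartial_add_smul h hχ hη a i] with x hx
  rw [Finset.mul_sum, ← Finset.sum_add_distrib]
  refine Finset.sum_congr rfl fun i _ => ?_
  rw [hx i]; ring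

lemma gradInner_add_smul_left (h : IsAdmissibleDomain bc Ω) {v χ η : Space d → ℝ}
    (hv : MemH1 Ω v) (hχ : MemH1 Ω χ) (hη : MemH1 Ω η) (a : ℝ) :
    gradInner Ω (fun x => χ x + a * η x) v = gradInner Ω χ v + a * gradInner Ω η v := by
  rw [gradInner_comm, gradInner_add_smul_right h hv hχ hη, gradInner_comm v χ,
    gradInner_comm v η]

lemma gradInner_const_right (h : IsAdmissibleDomain bc Ω) (v : Space d → ℝ) (a : ℝ) :
    gradInner Ω v (fun _ => a) = 0 := by
  unfold gradInner
  refine integral_eq_zero_of_ae ?_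
  filter_upwards [eventually_all.2 fun i => weakPartial_const h a i] with x hx
  exact Finset.sum_eq_zero fun i _ => by rw [hx i]; simp

lemma gradInner_add_smul_self (h : IsAdmissibleDomain bc Ω) {v χ : Space d → ℝ}
    (hv : MemH1 Ω v) (hχ : MemH1 Ω χ) (a : ℝ) :
    gradInner Ω (fun x => v x + a * χ x) (fun x => v x + a * χ x) =
      gradInner Ω v v + 2 * a * gradInner Ω v χ + a ^ 2 * gradInner Ω χ χ := by
  rw [gradInner_add_smul_right h (hv.add_smul h hχ a) hv hχ, gradInner_add_smul_left h hv hv hχ,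
    gradInner_add_smul_left h hχ hv hχ, gradInner_comm χ v]
  ring

end FormDomain

section Mean

lemma meanFree_eq (Ω : Set (Space d)) (v : Space d → ℝ) :
    meanFree Ω v = fun x => v x + (-1) * mean Ω v := by
  ext x; simp [meanFree, sub_eq_add_neg]

lemma MemL2.meanFree (h : IsAdmissibleDomain bc Ω) {v : Space d → ℝ} (hv : MemL2 Ω v) :
    MemL2 Ω (meanFree Ω v) := by
  rw [meanFree_eq]
  exact hv.add_smul (MemL2.const h _) _

lemma FormDomain.meanFree (h : IsAdmissibleDomain bc Ω) {v : Space d → ℝ}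
    (hv : FormDomain bc Ω v) : FormDomain bc Ω (meanFree Ω v) := by
  rw [meanFree_eq]
  exact hv.add_smul h (FormDomain.const h _) _

lemma gradInner_meanFree_right (h : IsAdmissibleDomain bc Ω) {v χ : Space d → ℝ}
    (hv : MemH1 Ω v) (hχ : MemH1 Ω χ) :
    gradInner Ω v (CahnHilliard.meanFree Ω χ) = gradInner Ω v χ := by
  rw [meanFree_eq, gradInner_add_smul_right h hv hχ (FormDomain.const h _).memH1,
    gradInner_const_right h, mul_zero, add_zero]

lemma mean_eq_innerL2_one (v : Space d → ℝ) :
    mean Ω v = (volume.real Ω)⁻¹ * innerL2 Ω v (fun _ => 1) := by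
  simp [mean, innerL2]

end Mean

section DualNorm

lemma normOne_sq (v : Space d → ℝ) : normOne Ω v ^ 2 = gradInner Ω v v :=
  Real.sq_sqrt (gradInner_self_nonneg v)

/-- One direction is Young's inequality. For the other, insert $s\chi$: the quadratic in $s$ stays
nonnegative, so its discriminant is nonpositive. -/
lemma normNegOne_le_iff (h : IsAdmissibleDomain bc Ω) {v : Space d → ℝ} (hv : MemL2 Ω v) {B : ℝ}
    (hB : 0 ≤ B) :
    normNegOne bc Ω v ≤ ENNReal.ofReal B ↔
      ∀ χ, FormDomain bc Ω χ → 2 * innerL2 Ω v χ - gradInner Ω χ χ ≤ B ^ 2 := by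
  have hiff : normNegOne bc Ω v ≤ ENNReal.ofReal B ↔
      ∀ χ, FormDomain bc Ω χ → |innerL2 Ω v χ| ≤ B * normOne Ω χ := by
    unfold normNegOne
    simp only [iSup_le_iff]
    refine forall₂_congr fun χ _ => ?_
    have h0 : 0 ≤ normOne Ω χ := Real.sqrt_nonneg _
    -- In `ℝ≥0∞`, $0/0=0$ and $a/0=\infty$ for $a>0$, so a $\chi$ with $|\chi|_1=0$ forces
    -- $(v,\chi)=0$.
    rcases h0.eq_or_lt with h1 | h1
    · rw [← h1, ENNReal.ofReal_zero, mul_zero]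
      rcases (abs_nonneg (innerL2 Ω v χ)).eq_or_lt with h2 | h2
      · simp [← h2]
      · rw [ENNReal.div_zero (by simpa using h2)]
        simp only [top_le_iff, ENNReal.ofReal_ne_top, false_iff, not_le]
        exact h2
    · rw [ENNReal.div_le_iff (by simpa using h1) ENNReal.ofReal_ne_top,
        ← ENNReal.ofReal_mul hB, ENNReal.ofReal_le_ofReal_iff (by positivity)]
  rw [hiff]
  refine ⟨fun hle χ hχ => ?_, fun hle χ hχ => ?_⟩
  · rw [← normOne_sq]
    nlinarith [le_abs_self (innerL2 Ω v χ), sq_nonneg (B - normOne Ω χ), hle χ hχ]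
  · have h0 := FormDomain.const (bc := bc) h 0
    have hs : ∀ s : ℝ, 0 ≤ gradInner Ω χ χ * (s * s) + -2 * innerL2 Ω v χ * s + B ^ 2 := fun s => by
      have h1 := hle _ (h0.add_smul h hχ s)
      rw [gradInner_add_smul_self h h0.memH1 hχ.memH1, gradInner_comm,
        innerL2_add_smul_right hv h0.memH1.1 hχ.memH1.1, gradInner_const_right h,
        gradInner_comm, gradInner_const_right h] at h1
      have h2 : innerL2 Ω v (fun _ => 0) = 0 := by simp [innerL2]
      rw [h2] at h1
      linarith
    have h3 := discrim_le_zero hs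
    unfold discrim at h3
    refine abs_le_of_sq_le_sq ?_ (mul_nonneg hB (Real.sqrt_nonneg _))
    rw [mul_pow, normOne_sq]
    linarith

end DualNorm

end CahnHilliard

/-! ### The nonlinearity: consequences of the growth conditions. -/

namespace CahnHilliard

/-- The growth conditions on the nonlinearity, with `c₂` the constant for `η = (p - 3/2) / α`. -/
structure IsPotential (p c₀ c₁ c₂ c₃ c α : ℝ) (f F : ℝ → ℝ) : Prop where
  F_zero : F 0 = 0
  hasDerivAt : ∀ v, HasDerivAt F (f v) v
  differentiable : Differentiable ℝ f
  two_le : 2 ≤ p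
  c₀_pos : 0 < c₀
  α_pos : 0 < α
  f_lower : ∀ v, p * c₀ * |v| ^ (2 * p) - c₁ ≤ f v * v
  f_upper : ∀ v, |f v| ≤ (p - 3 / 2) / α * c₀ * |v| ^ (2 * p) + c₂
  F_lower : ∀ v, 1 / 2 * c₀ * |v| ^ (2 * p) - c₃ ≤ F v
  F_upper : ∀ v, F v ≤ 3 / 2 * c₀ * |v| ^ (2 * p) + c₃
  deriv_lower : ∀ v, -c ≤ deriv f v

namespace IsPotential

variable {p c₀ c₁ c₂ c₃ c α : ℝ} {f F : ℝ → ℝ}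

lemma power_nonneg (hF : IsPotential p c₀ c₁ c₂ c₃ c α f F) (v : ℝ) :
    0 ≤ c₀ * |v| ^ (2 * p) :=
  mul_nonneg hF.c₀_pos.le (Real.rpow_nonneg (abs_nonneg v) _)

lemma power_zero (hF : IsPotential p c₀ c₁ c₂ c₃ c α f F) : |(0 : ℝ)| ^ (2 * p) = 0 := by
  rw [abs_zero, Real.zero_rpow]
  linarith [hF.two_le]

lemma c₃_nonneg (hF : IsPotential p c₀ c₁ c₂ c₃ c α f F) : 0 ≤ c₃ := by
  have := hF.F_lower 0
  rw [hF.power_zero, hF.F_zero] at this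
  linarith

lemma c₁_nonneg (hF : IsPotential p c₀ c₁ c₂ c₃ c α f F) : 0 ≤ c₁ := by
  have := hF.f_lower 0
  rw [hF.power_zero] at this
  linarith

lemma c₂_nonneg (hF : IsPotential p c₀ c₁ c₂ c₃ c α f F) : 0 ≤ c₂ := by
  have := hF.f_upper 0
  rw [hF.power_zero] at this
  linarith [abs_nonneg (f 0)]

/-- Makes $C_1(\alpha)$, hence $\hat\rho_0$, positive. If $c_1=c_2=0$, the two bounds on $f$ give
$p\le\eta v$ for every $v>0$, which fails at $v=p/(2\eta)$. -/
lemma const_pos (hF : IsPotential p c₀ c₁ c₂ c₃ c α f F) : 0 < c₂ * α + c₁ := by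
  have h1 := hF.c₁_nonneg
  have h2 := mul_nonneg hF.c₂_nonneg hF.α_pos.le
  by_contra hneg
  have hc₁ : c₁ = 0 := by linarith
  have hc₂ : c₂ = 0 := by
    have : c₂ * α = 0 := by linarith
    exact (mul_eq_zero.1 this).resolve_right hF.α_pos.ne'
  have hp := hF.two_le
  set η := (p - 3 / 2) / α with hη
  have hηpos : 0 < η := div_pos (by linarith) hF.α_pos
  set v := p / (2 * η) with hv
  have hvpos : 0 < v := by positivity
  have hX : 0 < c₀ * |v| ^ (2 * p) :=
    mul_pos hF.c₀_pos (Real.rpow_pos_of_pos (abs_pos.2 hvpos.ne') _)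
  have h3 := hF.f_lower v
  have h4 := (le_abs_self _).trans (hF.f_upper v)
  rw [hc₁] at h3
  rw [hc₂, ← hη] at h4
  have h5 := mul_le_mul_of_nonneg_right h4 hvpos.le
  have h6 : p * (c₀ * |v| ^ (2 * p)) ≤ η * v * (c₀ * |v| ^ (2 * p)) := by linarith
  have h7 := le_of_mul_le_mul_right h6 hX
  have h8 : η * v = p / 2 := by rw [hv]; field_simp
  linarith

lemma monotone (hF : IsPotential p c₀ c₁ c₂ c₃ c α f F) : Monotone fun v => f v + c * v := by
  refine monotone_of_deriv_nonneg (hF.differentiable.add (differentiable_id.const_mul c))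
    fun v => ?_
  have : HasDerivAt (fun v => f v + c * v) (deriv f v + c * 1) v :=
    (hF.differentiable v).hasDerivAt.add ((hasDerivAt_id v).const_mul c)
  rw [this.deriv]
  linarith [hF.deriv_lower v]

lemma mul_sub_lower (hF : IsPotential p c₀ c₁ c₂ c₃ c α f F) (a b : ℝ) :
    -c * ((a - b) * (a - b)) ≤ (f a - f b) * (a - b) := by
  rcases le_total a b with h | h
  · have := hF.monotone h
    nlinarith
  · have := hF.monotone h
    nlinarith

lemma convex_lower (hF : IsPotential p c₀ c₁ c₂ c₃ c α f F) (a b : ℝ) :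
    F a - F b - c / 2 * ((a - b) * (a - b)) ≤ f a * (a - b) := by
  have hd : ∀ v, HasDerivAt (fun v => F v + c / 2 * v ^ 2) (f v + c * v) v := fun v => by
    refine ((hF.hasDerivAt v).add ((hasDerivAt_pow 2 v).const_mul (c / 2))).congr_deriv ?_
    norm_num
    ring
  have hconv : ConvexOn ℝ univ fun v => F v + c / 2 * v ^ 2 := by
    refine Monotone.convexOn_univ_of_deriv (fun v => (hd v).differentiableAt) ?_
    rw [show deriv (fun v => F v + c / 2 * v ^ 2) = fun v => f v + c * v from
      funext fun v => (hd v).deriv]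
    exact hF.monotone
  have key : (f a + c * a) * (b - a) ≤ (F b + c / 2 * b ^ 2) - (F a + c / 2 * a ^ 2) := by
    rcases lt_trichotomy a b with h | rfl | h
    · have := hconv.le_slope_of_hasDerivAt (mem_univ a) (mem_univ b) h (hd a)
      rw [slope_def_field, le_div_iff₀ (sub_pos.2 h)] at this
      exact this
    · simp
    · have := hconv.slope_le_of_hasDerivAt (mem_univ b) (mem_univ a) h (hd a)
      rw [slope_def_field, div_le_iff₀ (sub_pos.2 h)] at this
      linarith
  nlinarith

/-- The choice of $\eta$ matters here: $m f(v)$ costs $(p-\frac32)c_0|v|^{2p}$, which leaves exactly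
the $\frac32c_0|v|^{2p}$ that dominates $F$. -/
lemma coercive (hF : IsPotential p c₀ c₁ c₂ c₃ c α f F) {m : ℝ} (hm : |m| ≤ α) (v : ℝ) :
    F v - (c₂ * α + c₁ + c₃) ≤ f v * (v - m) := by
  have h1 := hF.f_lower v
  have h2 := hF.F_upper v
  have h3 : m * f v ≤ α * ((p - 3 / 2) / α * c₀ * |v| ^ (2 * p) + c₂) := by
    calc m * f v ≤ |m * f v| := le_abs_self _
      _ = |m| * |f v| := abs_mul _ _
      _ ≤ _ := mul_le_mul hm (hF.f_upper v) (abs_nonneg _) hF.α_pos.le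
  have h4 : α * ((p - 3 / 2) / α * c₀ * |v| ^ (2 * p) + c₂) =
      (p - 3 / 2) * c₀ * |v| ^ (2 * p) + c₂ * α := by
    have := hF.α_pos.ne'
    field_simp
  linarith

lemma neg_c₃_le (hF : IsPotential p c₀ c₁ c₂ c₃ c α f F) (v : ℝ) : -c₃ ≤ F v := by
  linarith [hF.F_lower v, hF.power_nonneg v]

lemma abs_le (hF : IsPotential p c₀ c₁ c₂ c₃ c α f F) (v : ℝ) :
    |F v| ≤ f v * v + (c₁ + c₃) := by
  have h1 := mul_le_mul_of_nonneg_right hF.two_le (hF.power_nonneg v)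
  have h2 := hF.power_nonneg v
  have h3 := hF.f_lower v
  rw [abs_le']
  constructor
  · linarith [hF.F_upper v]
  · linarith [hF.neg_c₃_le v]

end IsPotential

/-! ### A priori estimates for the Euler scheme. -/

section Scheme

variable {d : ℕ} {bc : BoundaryCondition} {Ω : Set (Space d)}

lemma DomA.memL2_negLaplacian {v : Space d → ℝ} (hv : DomA bc Ω v) :
    MemL2 Ω (negLaplacian Ω v) :=
  MemLp.neg (memLp_finsetSum _ fun i _ => (hv.2.1.2 i).memL2_weakPartial i)

namespace IsEulerSolution

variable {ε p c₀ c₁ c₂ c₃ c α : ℝ} {f F : ℝ → ℝ} {t : ℕ → ℝ} {u₀ : Space d → ℝ}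
  {u w : ℕ → Space d → ℝ}

lemma memL2 (h : IsEulerSolution bc Ω ε f t u₀ u w) (n : ℕ) : MemL2 Ω (u n) := by
  cases n with
  | zero => rw [h.initial]; exact h.initial_mem
  | succ n => exact (h.mem_u n).1.memH1.1

lemma ae_eq (h : IsEulerSolution bc Ω ε f t u₀ u w) (hmono : StrictMono t) (n : ℕ) :
    ∀ᵐ x ∂(volume.restrict Ω),
      u n x = u (n + 1) x + (t (n + 1) - t n) * negLaplacian Ω (w (n + 1)) x := by
  have hk : t (n + 1) - t n ≠ 0 := (sub_pos.2 (hmono n.lt_succ_self)).ne'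
  filter_upwards [h.step n] with x hx
  field_simp at hx
  linarith

lemma innerL2_eq (h : IsEulerSolution bc Ω ε f t u₀ u w) (hmono : StrictMono t) (n : ℕ)
    {χ : Space d → ℝ} (hχ : FormDomain bc Ω χ) :
    innerL2 Ω (u n) χ = innerL2 Ω (u (n + 1)) χ +
      (t (n + 1) - t n) * gradInner Ω (w (n + 1)) χ := by
  rw [innerL2_congr_left χ (h.ae_eq hmono n), innerL2_add_smul_left hχ.memH1.1 (h.memL2 _)
    (h.mem_w n).memL2_negLaplacian, (h.mem_w n).2.2 χ hχ]

lemma mean_succ (hΩ : IsAdmissibleDomain bc Ω) (h : IsEulerSolution bc Ω ε f t u₀ u w)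
    (hmono : StrictMono t) (n : ℕ) : mean Ω (u (n + 1)) = mean Ω (u n) := by
  rw [mean_eq_innerL2_one, mean_eq_innerL2_one,
    h.innerL2_eq hmono n (FormDomain.const hΩ 1), gradInner_const_right hΩ, mul_zero, add_zero]

lemma mean_eq (hΩ : IsAdmissibleDomain bc Ω) (h : IsEulerSolution bc Ω ε f t u₀ u w)
    (hmono : StrictMono t) (n : ℕ) : mean Ω (u n) = mean Ω u₀ := by
  induction n with
  | zero => rw [h.initial]
  | succ n ih => rw [h.mean_succ hΩ hmono, ih]

lemma innerL2_meanFree (hΩ : IsAdmissibleDomain bc Ω) (h : IsEulerSolution bc Ω ε f t u₀ u w)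
    (hmono : StrictMono t) (n : ℕ) {χ : Space d → ℝ} (hχ : FormDomain bc Ω χ) :
    innerL2 Ω (meanFree Ω (u n)) χ = innerL2 Ω (meanFree Ω (u (n + 1))) χ +
      (t (n + 1) - t n) * gradInner Ω (w (n + 1)) χ := by
  have hc : ∀ a : ℝ, MemL2 Ω fun _ => a := MemL2.const hΩ
  rw [meanFree_eq, meanFree_eq, innerL2_add_smul_left hχ.memH1.1 (h.memL2 _) (hc _),
    innerL2_add_smul_left hχ.memH1.1 (h.memL2 _) (hc _), h.innerL2_eq hmono n hχ,
    h.mean_succ hΩ hmono n]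
  ring

/-- The potential equation gives $f(u)=\omega-\varepsilon Au\in L^2$, so no Sobolev embedding
enters; with `abs_le`, $F(u)$ is then integrable. -/
lemma memL2_nonlinearity (h : IsEulerSolution bc Ω ε f t u₀ u w) (n : ℕ) :
    MemL2 Ω fun x => f (u (n + 1) x) := by
  refine MemLp.ae_eq ?_ ((h.mem_w n).1.memH1.1.add_smul (h.mem_u n).memL2_negLaplacian (-ε))
  filter_upwards [h.potential n] with x hx
  rw [hx]; ring

lemma innerL2_potential (h : IsEulerSolution bc Ω ε f t u₀ u w) (n : ℕ) {χ : Space d → ℝ}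
    (hχ : FormDomain bc Ω χ) :
    innerL2 Ω (w (n + 1)) χ =
      ε * gradInner Ω (u (n + 1)) χ + innerL2 Ω (fun x => f (u (n + 1) x)) χ := by
  have h1 : ∀ᵐ x ∂(volume.restrict Ω),
      w (n + 1) x = f (u (n + 1) x) + ε * negLaplacian Ω (u (n + 1)) x := by
    filter_upwards [h.potential n] with x hx
    rw [hx, add_comm]
  rw [innerL2_congr_left χ h1, innerL2_add_smul_left hχ.memH1.1 (h.memL2_nonlinearity n)
    (h.mem_u n).memL2_negLaplacian, (h.mem_u n).2.2 χ hχ, add_comm]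

lemma integrable_potential (hΩ : IsAdmissibleDomain bc Ω)
    (h : IsEulerSolution bc Ω ε f t u₀ u w) (hF : IsPotential p c₀ c₁ c₂ c₃ c α f F) (n : ℕ) :
    Integrable (fun x => F (u (n + 1) x)) (volume.restrict Ω) := by
  have hc : Continuous F := continuous_iff_continuousAt.2 fun v => (hF.hasDerivAt v).continuousAt
  refine Integrable.mono' (((h.memL2_nonlinearity n).integrable_mul (h.memL2 (n + 1))).add
    ((MemL2.const hΩ (c₁ + c₃)).integrable hΩ))
    (hc.comp_aestronglyMeasurable (h.memL2 (n + 1)).1) (Eventually.of_forall fun x => ?_)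
  exact hF.abs_le _

lemma integral_potential_lower (hΩ : IsAdmissibleDomain bc Ω)
    (h : IsEulerSolution bc Ω ε f t u₀ u w) (hF : IsPotential p c₀ c₁ c₂ c₃ c α f F) (n : ℕ) :
    -(c₃ * volume.real Ω) ≤ ∫ x in Ω, F (u (n + 1) x) := by
  have h1 := integral_mono ((MemL2.const hΩ (-c₃)).integrable hΩ)
    (h.integrable_potential hΩ hF n) fun x => hF.neg_c₃_le (u (n + 1) x)
  rw [setIntegral_const, smul_eq_mul] at h1
  linarith

lemma innerL2_meanFree_lower (hΩ : IsAdmissibleDomain bc Ω)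
    (h : IsEulerSolution bc Ω ε f t u₀ u w) (hF : IsPotential p c₀ c₁ c₂ c₃ c α f F)
    (hmono : StrictMono t) (hm : |mean Ω u₀| ≤ α) (n : ℕ) :
    ε * gradInner Ω (u (n + 1)) (u (n + 1)) + (∫ x in Ω, F (u (n + 1) x)) -
      (c₂ * α + c₁ + c₃) * volume.real Ω ≤ innerL2 Ω (meanFree Ω (u (n + 1))) (w (n + 1)) := by
  have hfd := (h.mem_u n).1
  rw [innerL2_comm, h.innerL2_potential n (hfd.meanFree hΩ),
    gradInner_meanFree_right hΩ hfd.memH1 hfd.memH1]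
  have h1 := integral_mono ((h.integrable_potential hΩ hF n).sub
      ((MemL2.const hΩ (c₂ * α + c₁ + c₃)).integrable hΩ))
    ((h.memL2_nonlinearity n).integrable_mul (MemL2.meanFree hΩ (h.memL2 (n + 1))))
    fun x => hF.coercive (m := mean Ω (u (n + 1))) (by rwa [h.mean_eq hΩ hmono]) (u (n + 1) x)
  rw [integral_sub' (h.integrable_potential hΩ hF n)
    ((MemL2.const hΩ _).integrable hΩ), setIntegral_const, smul_eq_mul] at h1
  unfold innerL2
  linarith

/-- Since $\bar u^n=\bar u^{n+1}+k_nA\omega^{n+1}$, this expands $|\bar u^n|_{-1}^2$. Testing the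
variational bound for $\bar u^n$ with $\chi+k_n\omega^{n+1}$ yields the one for $\bar u^{n+1}$. -/
lemma dual_le (hΩ : IsAdmissibleDomain bc Ω) (h : IsEulerSolution bc Ω ε f t u₀ u w)
    (hmono : StrictMono t) (n : ℕ) {B : ℝ} (hB : 0 ≤ B)
    (hn : normNegOne bc Ω (meanFree Ω (u n)) ≤ ENNReal.ofReal B) :
    (normNegOne bc Ω (meanFree Ω (u (n + 1)))).toReal ^ 2 +
      (t (n + 1) - t n) ^ 2 * gradInner Ω (w (n + 1)) (w (n + 1)) +
      2 * (t (n + 1) - t n) * innerL2 Ω (meanFree Ω (u (n + 1))) (w (n + 1)) ≤ B ^ 2 := by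
  set k := t (n + 1) - t n with hk
  set W := w (n + 1)
  set Q := B ^ 2 - k ^ 2 * gradInner Ω W W -
    2 * k * innerL2 Ω (meanFree Ω (u (n + 1))) W with hQ
  have hW := (h.mem_w n).1
  have hu : ∀ i, MemL2 Ω (meanFree Ω (u i)) := fun i => MemL2.meanFree hΩ (h.memL2 i)
  rw [normNegOne_le_iff hΩ (hu n) hB] at hn
  have key : ∀ χ, FormDomain bc Ω χ →
      2 * innerL2 Ω (meanFree Ω (u (n + 1))) χ - gradInner Ω χ χ ≤ Q := by
    intro χ hχ
    have h1 := hn _ (hχ.add_smul hΩ hW k)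
    rw [gradInner_add_smul_self hΩ hχ.memH1 hW.memH1,
      h.innerL2_meanFree hΩ hmono n (hχ.add_smul hΩ hW k),
      innerL2_add_smul_right (hu _) hχ.memH1.1 hW.memH1.1,
      gradInner_add_smul_right hΩ hW.memH1 hχ.memH1 hW.memH1, gradInner_comm χ W] at h1
    simp only [← hk] at h1
    linarith
  have hQ0 : 0 ≤ Q := by
    have h1 := key _ (FormDomain.const hΩ 0)
    rw [gradInner_const_right hΩ] at h1
    simpa [innerL2] using h1
  have hle := (normNegOne_le_iff hΩ (hu (n + 1)) (Real.sqrt_nonneg Q)).2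
    (by rwa [Real.sq_sqrt hQ0])
  have h2 := pow_le_pow_left₀ ENNReal.toReal_nonneg
    (ENNReal.toReal_le_of_le_ofReal (Real.sqrt_nonneg Q) hle) 2
  rw [Real.sq_sqrt hQ0] at h2
  linarith

lemma innerL2_sub (h : IsEulerSolution bc Ω ε f t u₀ u w) (hmono : StrictMono t) (n : ℕ)
    {χ : Space d → ℝ} (hχ : FormDomain bc Ω χ) :
    innerL2 Ω (fun x => u (n + 1) x + (-1) * u n x) χ =
      -((t (n + 1) - t n) * gradInner Ω (w (n + 1)) χ) := by
  rw [innerL2_add_smul_left hχ.memH1.1 (h.memL2 _) (h.memL2 _), h.innerL2_eq hmono n hχ]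
  ring

/-- Test the potential equation with $\delta=u^{n+2}-u^{n+1}$. Convexity of $F+\frac c2v^2$ costs
$\frac c2\|\delta\|^2$, and $\|\delta\|^2=-k(\nabla\omega,\nabla\delta)$ by the scheme. Indices
start at $1$ because $u^0$ is only in $L^2$. -/
lemma energy_le (hΩ : IsAdmissibleDomain bc Ω) (h : IsEulerSolution bc Ω ε f t u₀ u w)
    (hF : IsPotential p c₀ c₁ c₂ c₃ c α f F) (hε : 0 < ε) (hmono : StrictMono t) (n : ℕ) :
    ε / 2 * gradInner Ω (u (n + 2)) (u (n + 2)) + (∫ x in Ω, F (u (n + 2) x)) +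
        (t (n + 2) - t (n + 1)) * gradInner Ω (w (n + 2)) (w (n + 2)) ≤
      ε / 2 * gradInner Ω (u (n + 1)) (u (n + 1)) + (∫ x in Ω, F (u (n + 1) x)) +
        c ^ 2 / (8 * ε) * ((t (n + 2) - t (n + 1)) ^ 2 *
          gradInner Ω (w (n + 2)) (w (n + 2))) := by
  set k := t (n + 2) - t (n + 1) with hk
  have hu := (h.mem_u n).1
  have hu' := (h.mem_u (n + 1)).1
  have hw' := (h.mem_w (n + 1)).1
  set δ : Space d → ℝ := fun x => u (n + 2) x + (-1) * u (n + 1) x with hδ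
  have hδd : FormDomain bc Ω δ := hu'.add_smul hΩ hu (-1)
  have h1 : innerL2 Ω δ (w (n + 2)) = -(k * gradInner Ω (w (n + 2)) (w (n + 2))) :=
    h.innerL2_sub hmono (n + 1) hw'
  have h2 : innerL2 Ω δ δ = -(k * gradInner Ω (w (n + 2)) δ) :=
    h.innerL2_sub hmono (n + 1) hδd
  have h3 := h.innerL2_potential (n + 1) hδd
  have h4 : (∫ x in Ω, F (u (n + 2) x)) - (∫ x in Ω, F (u (n + 1) x)) -
      c / 2 * innerL2 Ω δ δ ≤ innerL2 Ω (fun x => f (u (n + 2) x)) δ := by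
    have hi := h.integrable_potential hΩ hF n
    have hi' := h.integrable_potential hΩ hF (n + 1)
    have hsub : Integrable (fun x => F (u (n + 2) x) - F (u (n + 1) x))
      (volume.restrict Ω) := hi'.sub hi
    have hδi := hδd.memH1.1.integrable_mul hδd.memH1.1
    unfold innerL2
    rw [← integral_const_mul, ← integral_sub hi' hi,
      ← integral_sub hsub (hδi.const_mul _)]
    refine integral_mono (hsub.sub (hδi.const_mul _))
      ((h.memL2_nonlinearity (n + 1)).integrable_mul hδd.memH1.1) fun x => ?_
    have := hF.convex_lower (u (n + 2) x) (u (n + 1) x)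
    simp only [hδ, neg_one_mul, ← sub_eq_add_neg]
    exact this
  have h5 := gradInner_add_smul_self hΩ hu'.memH1 hu.memH1 (-1)
  have h6 := gradInner_add_smul_right hΩ hu'.memH1 hu'.memH1 hu.memH1 (-1)
  -- The weight $ck/(2\varepsilon)$ completes the square in $\frac\varepsilon2|\delta|_1^2+\frac
  -- c2k(\nabla\omega,\nabla\delta)$.
  have h7 := gradInner_add_smul_self hΩ hδd.memH1 hw'.memH1 (c * k / (2 * ε))
  have h8 : 0 ≤ ε / 2 * (gradInner Ω δ δ + 2 * (c * k / (2 * ε)) * gradInner Ω δ (w (n + 2)) +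
      (c * k / (2 * ε)) ^ 2 * gradInner Ω (w (n + 2)) (w (n + 2))) := by
    rw [← h7]
    exact mul_nonneg (by positivity) (gradInner_self_nonneg _)
  have h9 : ε / 2 * (gradInner Ω δ δ + 2 * (c * k / (2 * ε)) * gradInner Ω δ (w (n + 2)) +
      (c * k / (2 * ε)) ^ 2 * gradInner Ω (w (n + 2)) (w (n + 2))) =
      ε / 2 * gradInner Ω δ δ + c / 2 * (k * gradInner Ω (w (n + 2)) δ) +
        c ^ 2 / (8 * ε) * (k ^ 2 * gradInner Ω (w (n + 2)) (w (n + 2))) := by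
    rw [gradInner_comm δ (w (n + 2))]; field_simp; ring
  rw [h9] at h8
  rw [innerL2_comm, h1] at h3
  simp only [Nat.add_assoc, Nat.reduceAdd, ← hδ] at h3 h5 h6
  rw [h2] at h4
  rw [h6] at h3
  rw [h5] at h8
  linarith

lemma growth_le (hΩ : IsAdmissibleDomain bc Ω) (h : IsEulerSolution bc Ω ε f t u₀ u w)
    (hF : IsPotential p c₀ c₁ c₂ c₃ c α f F) (hε : 0 < ε) (hc : 0 < c) (hmono : StrictMono t)
    (n : ℕ) (hstep : t (n + 2) - t (n + 1) < 2 * ε / c ^ 2) :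
    (1 - c ^ 2 * (t (n + 2) - t (n + 1)) / (4 * ε)) ^ 2 *
      gradInner Ω (w (n + 2)) (w (n + 2)) ≤ gradInner Ω (w (n + 1)) (w (n + 1)) := by
  have hkpos : 0 < t (n + 2) - t (n + 1) := sub_pos.2 (hmono (n + 1).lt_succ_self)
  set k := t (n + 2) - t (n + 1) with hk
  have hu := (h.mem_u n).1
  have hu' := (h.mem_u (n + 1)).1
  have hw := (h.mem_w n).1
  have hw' := (h.mem_w (n + 1)).1
  set δ : Space d → ℝ := fun x => u (n + 2) x + (-1) * u (n + 1) x with hδ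
  have hδd : FormDomain bc Ω δ := hu'.add_smul hΩ hu (-1)
  have h1 : innerL2 Ω δ (w (n + 2)) = -(k * gradInner Ω (w (n + 2)) (w (n + 2))) :=
    h.innerL2_sub hmono (n + 1) hw'
  have h1' : innerL2 Ω δ (w (n + 1)) = -(k * gradInner Ω (w (n + 2)) (w (n + 1))) :=
    h.innerL2_sub hmono (n + 1) hw
  have h2 : innerL2 Ω δ δ = -(k * gradInner Ω (w (n + 2)) δ) :=
    h.innerL2_sub hmono (n + 1) hδd
  have h3 := h.innerL2_potential (n + 1) hδd
  have h3' := h.innerL2_potential n hδd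
  have h4 : -c * innerL2 Ω δ δ ≤
      innerL2 Ω (fun x => f (u (n + 2) x)) δ - innerL2 Ω (fun x => f (u (n + 1) x)) δ := by
    have hi := (h.memL2_nonlinearity n).integrable_mul hδd.memH1.1
    have hi' := (h.memL2_nonlinearity (n + 1)).integrable_mul hδd.memH1.1
    unfold innerL2
    rw [← integral_const_mul, ← integral_sub hi' hi]
    refine integral_mono ((hδd.memH1.1.integrable_mul hδd.memH1.1).const_mul _)
      (hi'.sub hi) fun x => ?_
    have := hF.mul_sub_lower (u (n + 2) x) (u (n + 1) x)
    simp only [hδ, neg_one_mul, ← sub_eq_add_neg, ← sub_mul]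
    exact this
  have h6 := gradInner_add_smul_left hΩ hδd.memH1 hu'.memH1 hu.memH1 (-1)
  have h7 := gradInner_add_smul_self hΩ hδd.memH1 hw'.memH1 (c * k / (2 * ε))
  have h8 : 0 ≤ ε * (gradInner Ω δ δ + 2 * (c * k / (2 * ε)) * gradInner Ω δ (w (n + 2)) +
      (c * k / (2 * ε)) ^ 2 * gradInner Ω (w (n + 2)) (w (n + 2))) := by
    rw [← h7]
    exact mul_nonneg hε.le (gradInner_self_nonneg _)
  set x := c ^ 2 * k / (4 * ε) with hx
  have h9 : ε * (gradInner Ω δ δ + 2 * (c * k / (2 * ε)) * gradInner Ω δ (w (n + 2)) +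
      (c * k / (2 * ε)) ^ 2 * gradInner Ω (w (n + 2)) (w (n + 2))) =
      ε * gradInner Ω δ δ + c * (k * gradInner Ω (w (n + 2)) δ) +
        k * (x * gradInner Ω (w (n + 2)) (w (n + 2))) := by
    rw [gradInner_comm δ (w (n + 2)), hx]; field_simp; ring
  rw [h9] at h8
  rw [innerL2_comm, h1] at h3
  rw [innerL2_comm, h1'] at h3'
  simp only [Nat.add_assoc, Nat.reduceAdd, ← hδ] at h3 h6
  rw [h2] at h4
  -- The difference of the two potential equations, tested with $\delta$, after completing the
  -- square as in `energy_le`.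
  have h10 : k * ((1 - x) * gradInner Ω (w (n + 2)) (w (n + 2))) ≤
      k * gradInner Ω (w (n + 2)) (w (n + 1)) := by
    have h6' : ε * gradInner Ω δ δ =
        ε * gradInner Ω (u (n + 2)) δ - ε * gradInner Ω (u (n + 1)) δ := by
      rw [show gradInner Ω δ δ = _ from h6]; ring
    linarith
  have h11 := le_of_mul_le_mul_left h10 hkpos
  have hx1 : x ≤ 1 / 2 := by
    rw [hx, div_le_iff₀ (by positivity)]
    have := (lt_div_iff₀ (by positivity)).1 hstep
    linarith
  -- Instead of Cauchy–Schwarz, expand $|\omega^{n+1}-(1-x)\omega^{n+2}|_1^2\ge0$.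
  have h12 := gradInner_add_smul_self hΩ hw.memH1 hw'.memH1 (-(1 - x))
  have h13 := gradInner_self_nonneg (Ω := Ω) fun y => w (n + 1) y + -(1 - x) * w (n + 2) y
  rw [h12, gradInner_comm (w (n + 1)) (w (n + 1 + 1))] at h13
  simp only [Nat.add_assoc, Nat.reduceAdd] at h13
  have h14 := mul_le_mul_of_nonneg_left h11 (by linarith : 0 ≤ 1 - x)
  linarith

lemma estimates (hΩ : IsAdmissibleDomain bc Ω) (h : IsEulerSolution bc Ω ε f t u₀ u w)
    (hF : IsPotential p c₀ c₁ c₂ c₃ c α f F) (hε : 0 < ε) (hc : 0 < c) (hmono : StrictMono t)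
    (hstep : ∀ n, t (n + 1) - t n < 2 * ε / c ^ 2) {γ R : ℝ} (hγ : 0 < γ) (hR : 0 ≤ R)
    (hγb : ∀ v, FormDomain bc Ω v →
      normNegOne bc Ω (meanFree Ω v) ≤ ENNReal.ofReal (γ * normOne Ω v))
    (hu₀ : normNegOne bc Ω (meanFree Ω u₀) ≤ ENNReal.ofReal R) (hm : |mean Ω u₀| ≤ α) :
    Estimates ε c γ ((c₂ * α + c₁ + c₃) * volume.real Ω) (c₃ * volume.real Ω) R t
      (fun n => (normNegOne bc Ω (meanFree Ω (u n))).toReal)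
      (fun n => gradInner Ω (u n) (u n)) (fun n => ∫ x in Ω, F (u n x))
      (fun n => gradInner Ω (w n) (w n)) := by
  rw [← h.initial] at hu₀
  have hfin : ∀ n, normNegOne bc Ω (meanFree Ω (u n)) ≠ ⊤ := fun n => by
    cases n with
    | zero => exact (hu₀.trans_lt ENNReal.ofReal_lt_top).ne
    | succ n => exact ((hγb _ (h.mem_u n).1).trans_lt ENNReal.ofReal_lt_top).ne
  refine ⟨fun n => ENNReal.toReal_nonneg, ENNReal.toReal_le_of_le_ofReal hR hu₀,
    fun n => gradInner_self_nonneg _, fun n => gradInner_self_nonneg _,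
    fun n => h.integral_potential_lower hΩ hF n, fun n => ?_, fun n => ?_, fun n hn => ?_,
    fun n hn => ?_⟩
  · have h0 : 0 ≤ γ * normOne Ω (u (n + 1)) := mul_nonneg hγ.le (Real.sqrt_nonneg _)
    have h1 := pow_le_pow_left₀ ENNReal.toReal_nonneg
      (ENNReal.toReal_le_of_le_ofReal h0 (hγb _ (h.mem_u n).1)) 2
    rwa [mul_pow, normOne_sq] at h1
  · have h1 := h.dual_le hΩ hmono n ENNReal.toReal_nonneg
      (ENNReal.ofReal_toReal (hfin n)).ge
    have h2 := mul_le_mul_of_nonneg_left (h.innerL2_meanFree_lower hΩ hF hmono hm n)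
      (by linarith [hmono n.lt_succ_self] : 0 ≤ 2 * (t (n + 1) - t n))
    linarith
  · obtain ⟨n, rfl⟩ := Nat.exists_eq_add_of_le' hn
    exact h.energy_le hΩ hF hε hmono n
  · obtain ⟨n, rfl⟩ := Nat.exists_eq_add_of_le' hn
    exact h.growth_le hΩ hF hε hc hmono n (hstep (n + 1))

end IsEulerSolution

lemma exists_admissibleSteps {t : ℕ → ℝ} (ht : IsTimePartition t) (T r : ℝ) :
    ∃ n₀ N₁ nω : ℕ, AdmissibleSteps t T r n₀ N₁ nω := by
  obtain ⟨n₀, h1, h2⟩ := ((ht.2.2.eventually_ge_atTop T).and (eventually_gt_atTop 0)).exists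
  obtain ⟨M, h3, h4⟩ :=
    ((ht.2.2.eventually_ge_atTop (r + t n₀)).and (eventually_ge_atTop n₀)).exists
  obtain ⟨N₁, rfl⟩ := Nat.exists_eq_add_of_le h4
  exact ⟨n₀, N₁, n₀ + N₁ + 1, h2, h1, by linarith, sub_pos.2 (ht.2.1 (Nat.lt_succ_self _))⟩

lemma rhoHat_sq {ε c γ C : ℝ} (hε : 0 < ε) (hC : 0 ≤ C) :
    rhoHat ε c γ C ^ 2 = 2 * C * (γ ^ 2 / ε + 8 * ε / c ^ 2) := by
  unfold rhoHat
  rw [mul_pow, Real.sq_sqrt (by linarith), Real.sq_sqrt (by positivity)]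

end Scheme

end CahnHilliard

theorem mainTheorem3 {d : ℕ} (hd1 : 1 ≤ d) (hd3 : d ≤ 3)
    (bc : CahnHilliard.BoundaryCondition) (Ω : Set (CahnHilliard.Space d))
    (hΩ : CahnHilliard.IsAdmissibleDomain bc Ω)
    (ε : ℝ) (hε : 0 < ε)
    -- the nonlinearity `f = F'` and the growth conditions
    (f F : ℝ → ℝ) (hF0 : F 0 = 0) (hF : ∀ v, HasDerivAt F (f v) v) (hf : Differentiable ℝ f)
    (p : ℝ) (hp : 2 ≤ p) (hp3 : d = 3 → p = 2)
    (c₀ c₁ c₃ c : ℝ) (c₂ : ℝ → ℝ) (hc₀ : 0 < c₀) (hc : 0 < c)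
    (hf_lower : ∀ v, p * c₀ * |v| ^ (2 * p) - c₁ ≤ f v * v)
    (hf_upper : ∀ η, 0 < η → ∀ v, |f v| ≤ η * c₀ * |v| ^ (2 * p) + c₂ η)
    (hF_lower : ∀ v, 1 / 2 * c₀ * |v| ^ (2 * p) - c₃ ≤ F v)
    (hF_upper : ∀ v, F v ≤ 3 / 2 * c₀ * |v| ^ (2 * p) + c₃)
    (hf_deriv : ∀ v, -c ≤ deriv f v)
    -- the constant of `|v - m(v)|₋₁ ≤ γ₁ |v|₁`
    (γ₁ : ℝ) (hγ₁ : 0 < γ₁)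
    (hγ₁_bound : ∀ v, CahnHilliard.FormDomain bc Ω v →
      CahnHilliard.normNegOne bc Ω (CahnHilliard.meanFree Ω v) ≤
        ENNReal.ofReal (γ₁ * CahnHilliard.normOne Ω v))
    (R α : ℝ) (hR : 0 ≤ R) (hα : 0 < α)
    -- the time mesh, with largest step `k`
    (t : ℕ → ℝ) (ht : CahnHilliard.IsTimePartition t)
    (k : ℝ) (hk : IsLUB (Set.range fun n => t (n + 1) - t n) k) (hkc : k < 2 * ε / c ^ 2)
    (r : ℝ) (hr : 0 < r)
    -- the constants `C₀(α)`, `C₁(α)`, `ρ̂₀`, `ρ̂₀'`, `C₂(r)` and the threshold time of `n₀`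
    (C₀ C₁ ρ₀ ρ₀' C₂ T : ℝ)
    (hC₀ : C₀ = CahnHilliard.constC0 c₁ (c₂ ((p - 3 / 2) / α)) c₃ α (MeasureTheory.volume.real Ω))
    (hC₁ : C₁ = CahnHilliard.constC1 c₁ (c₂ ((p - 3 / 2) / α)) c₃ α (MeasureTheory.volume.real Ω))
    (hρ₀ : ρ₀ = CahnHilliard.rhoHat ε c γ₁ C₁)
    (hρ₀' : ρ₀' = CahnHilliard.rhoHatPrime ε c γ₁ C₁)
    (hC₂ : C₂ = CahnHilliard.constC2 C₀ ρ₀' r)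
    (hT : T = (γ₁ ^ 2 / ε + 8 * ε / c ^ 2) * Real.log (R ^ 2 / ρ₀ ^ 2)) :
    (∃ n₀ N₁ nω : ℕ, CahnHilliard.AdmissibleSteps t T r n₀ N₁ nω) ∧
    ∀ n₀ N₁ nω : ℕ, CahnHilliard.AdmissibleSteps t T r n₀ N₁ nω →
      ∀ (u₀ : CahnHilliard.Space d → ℝ) (u w : ℕ → CahnHilliard.Space d → ℝ),
        CahnHilliard.IsEulerSolution bc Ω ε f t u₀ u w →
        CahnHilliard.normNegOne bc Ω (CahnHilliard.meanFree Ω u₀) ≤ ENNReal.ofReal R →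
        |CahnHilliard.mean Ω u₀| ≤ α →
        ∀ n, nω ≤ n →
          CahnHilliard.normOne Ω (w n) ≤
            Real.sqrt (CahnHilliard.rhoOmegaSq ε c C₁ ρ₀' C₂ (t nω - t (n₀ + N₁))) := by
  refine ⟨CahnHilliard.exists_admissibleSteps ht T r, ?_⟩
  rintro n₀ N₁ nω ⟨hn₀, hTn, hrn, hω⟩ u₀ u w hsol hu₀ hm n hn
  have hF' : CahnHilliard.IsPotential p c₀ c₁ (c₂ ((p - 3 / 2) / α)) c₃ c α f F :=
    ⟨hF0, hF, hf, hp, hc₀, hα, hf_lower, hf_upper _ (div_pos (by linarith) hα), hF_lower,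
      hF_upper, hf_deriv⟩
  have hstep : ∀ n, t (n + 1) - t n < 2 * ε / c ^ 2 := fun n =>
    (hk.1 (Set.mem_range_self n)).trans_lt hkc
  have hest := hsol.estimates hΩ hF' hε hc ht.2.1 hstep hγ₁ hR hγ₁_bound hu₀ hm
  have hvol := hΩ.volume_real_pos
  have hC₀' : 0 < C₀ := by
    rw [hC₀]
    exact mul_pos (by linarith [hF'.const_pos, hF'.c₃_nonneg]) hvol
  -- With $B=c_3|\Omega|$, the sum $C_0+B$ in the sequence estimates is $C_1(\alpha)$.
  have hC₁' : C₁ = C₀ + c₃ * MeasureTheory.volume.real Ω := by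
    rw [hC₁, hC₀, CahnHilliard.constC1, CahnHilliard.constC0]; ring
  have hC₁pos : 0 < C₁ := by
    rw [hC₁']
    exact add_pos_of_pos_of_nonneg hC₀' (mul_nonneg hF'.c₃_nonneg hvol.le)
  have hρsq : ρ₀ ^ 2 = 2 * C₁ * (γ₁ ^ 2 / ε + 8 * ε / c ^ 2) :=
    hρ₀ ▸ CahnHilliard.rhoHat_sq hε hC₁pos.le
  have hρ' : ρ₀' = 2 * ρ₀ := by rw [hρ₀', hρ₀, CahnHilliard.rhoHatPrime]
  rw [← CahnHilliard.constC0, ← hC₀] at hest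
  rw [hT] at hTn
  rw [hC₁'] at hρsq hC₁pos
  refine Real.sqrt_le_sqrt ?_
  rw [CahnHilliard.rhoOmegaSq, hC₂, CahnHilliard.constC2, hρ', hC₁']
  exact hest.y_le hε hc hγ₁ ht.1 ht.2.1 hstep hC₀'.le hC₁pos hr hρsq hn₀ hTn
    (Nat.le_add_right n₀ N₁) hrn hω hn
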